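/- Let $w=w_-:[0,1]\to[0,1]$ be a continuous, strictly increasing probability weighting function with $w(0)=0$, $w(1)=1$, $w'(0)>1$, $w'(1)>1$ (one-sided derivatives, the value $+\infty$ being allowed), three times differentiable on $(0,1)$ with $w'''>0$ there. Let $\theta\ge 0$ be the value of the good and $\lambda>0$ the loss-aversion coefficient. Let $\tau_0$ be an exponentially distributed time, $P(\tau_0>t)=e^{-t}$ for $t\ge 0$. A cumulative payment function is a function $T:[0,\infty)\to[0,\infty)$ of the form $T(t)=\int_0^t f_T(s)\,ds+\sum_{i}1_{t_i<t}\,T_i$, with $f_T\ge 0$ locally integrable on $[0,\infty)$, sequences $t_i\ge0$, $T_i\ge 0$, and $\sum_{t_i<t}T_i<\infty$ for every $t$. It satisfies dynamic individual rationality (DIR) if $$\lambda\int_0^\infty w\big(P(T(\tau_0)-T(s)>y\mid \tau_0>s)\big)\,dy\le\theta\qquad\text{for all } s\ge 0,$$ and it is optimal for $\tau_0$ if it satisfies DIR and maximizes the expected profit $\int_0^\infty P(T(\tau_0)>y)\,dy$ among all cumulative payment functions that satisfy DIR. **Proposition.** 1. There is a unique $p_1\in(0,1)$ with $w(p_1)=p_1$.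 2. There is a unique $g_0\in L^1[0,-\log p_1]$ (up to null sets) with $$e^{-t}-w(e^{-t})-\int_0^t w(e^{-t+s})g_0(s)\,ds=0\qquad\text{for all } t\in[0,-\log p_1].$$ It has a representative that is continuous on $(0,-\log p_1]$ and tends to $w'(1)-1\in(0,+\infty]$ as $t\downarrow0$. Take this representative, with $g_0(0)=w'(1)-1$; then the minimum $$t_0=\min\{t\in[0,-\log p_1] : g_0(t)\le 0\}$$ exists (and $t_0>0$). 3. There is a unique $f\in L^1[0,t_0]$ (up to null sets) with $$w(e^{-t_0+t})+\int_t^{t_0}w(e^{-s+t})f(s)\,ds=1\qquad\text{for all } t\in[0,t_0].$$ 4. The function $$T^*(t)=\frac{\theta}{\lambda}\Big(1_{t>t_0}+\int_0^{\min\{t,t_0\}}f(s)\,ds\Big)$$ is a cumulative payment function for which DIR holds with equality at every $s\in[0,t_0]$; it is optimal for $\tau_0$, and it is the only optimal one: every cumulative payment function $T$ that is optimal for $\tau_0$ satisfies $T(t)=T^*(t)$ for all $t\ge 0$. -/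

import Mathlib

open Set Filter Topology MeasureTheory

noncomputable section

/-- `d` is the derivative of `w` at `x` relative to the set `s`, in the extended sense:
the difference quotients converge to `d` in `[-∞, +∞]` (so `d = ⊤` is an infinite slope). -/
def HasExtDerivWithin (w : ℝ → ℝ) (s : Set ℝ) (x : ℝ) (d : EReal) : Prop :=
  Tendsto (fun p => ((slope w x p : ℝ) : EReal)) (𝓝[s \ {x}] x) (𝓝 d)

/-- Probability weighting functions of reverse S shape on `[0,1]`: continuous, strictly
increasing, `w(0) = 0`, `w(1) = 1`, `w'(0) > 1`, `w'(1) > 1` (the end-point slopes may be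
infinite, as for `p^γ / (p^γ + (1-p)^γ)^(1/γ)`), and `w''' > 0` on `(0,1)`.
Only the values of `w` on `[0,1]` matter. -/
structure IsWeighting (w : ℝ → ℝ) : Prop where
  continuousOn : ContinuousOn w (Icc 0 1)
  strictMonoOn : StrictMonoOn w (Icc 0 1)
  map_zero : w 0 = 0
  map_one : w 1 = 1
  slope_zero : ∃ d : EReal, HasExtDerivWithin w (Icc 0 1) 0 d ∧ 1 < d
  slope_one : ∃ d : EReal, HasExtDerivWithin w (Icc 0 1) 1 d ∧ 1 < d
  differentiableAt : ∀ n < 3, ∀ p ∈ Ioo (0 : ℝ) 1, DifferentiableAt ℝ (iteratedDeriv n w) p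
  third_pos : ∀ p ∈ Ioo (0 : ℝ) 1, 0 < iteratedDeriv 3 w p

/-- `τ` is an exponentially distributed random time: `P(τ > t) = e^{-t}` for `t ≥ 0`. -/
structure IsExpTime {Ω : Type*} [MeasurableSpace Ω] (P : Measure Ω) (τ : Ω → ℝ) : Prop where
  measurable : Measurable τ
  tail : ∀ t : ℝ, 0 ≤ t → P {ω | t < τ ω} = ENNReal.ofReal (Real.exp (-t))

/-- Cumulative payment functions on `[0,∞)` with a regular decomposition
`T(t) = ∫_0^t f + ∑_i 1_{t_i < t} T_i`: a nonnegative flow payment `f`, and lump sums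
`T_i ≥ 0` paid at times `t_i ≥ 0`; all amounts paid up to a finite time are finite. -/
def IsPayment (T : ℝ → ℝ) : Prop :=
  ∃ (f : ℝ → ℝ) (time lump : ℕ → ℝ),
    (∀ s, 0 ≤ f s) ∧ (∀ t, 0 ≤ t → IntervalIntegrable f volume 0 t) ∧
    (∀ i, 0 ≤ time i) ∧ (∀ i, 0 ≤ lump i) ∧
    ∀ t, 0 ≤ t → HasSum (fun i => if time i < t then lump i else 0) (T t - ∫ s in 0..t, f s)

/-- The buyer's perceived cost, at time `s` and given that `τ > s`, of all payments still to come: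
`λ ∫_0^∞ w(P(T(τ) - T(s) > y | τ > s)) dy`, with values in `[0,∞]`. -/
def perceivedCost {Ω : Type*} [MeasurableSpace Ω] (P : Measure Ω) (τ : Ω → ℝ) (w : ℝ → ℝ)
    (lam : ℝ) (T : ℝ → ℝ) (s : ℝ) : ENNReal :=
  ENNReal.ofReal lam * ∫⁻ y in Ioi (0 : ℝ), ENNReal.ofReal
    (w ((ProbabilityTheory.cond P {ω | s < τ ω}).real {ω | y < T (τ ω) - T s}))

/-- Dynamic individual rationality for a finite stopping time `τ` (the good is eventually
delivered, which has value `θ`): the perceived cost is at most `θ` at every time `s ≥ 0` with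
`P(τ > s) > 0`. -/
def DIR {Ω : Type*} [MeasurableSpace Ω] (P : Measure Ω) (τ : Ω → ℝ) (w : ℝ → ℝ)
    (θ lam : ℝ) (T : ℝ → ℝ) : Prop :=
  ∀ s : ℝ, 0 ≤ s → 0 < P {ω | s < τ ω} → perceivedCost P τ w lam T s ≤ ENNReal.ofReal θ

/-- The seller's expected profit `∫_0^∞ P(T(τ) > y) dy`, in `[0,∞]`. -/
def profit {Ω : Type*} [MeasurableSpace Ω] (P : Measure Ω) (τ : Ω → ℝ) (T : ℝ → ℝ) : ENNReal :=
  ∫⁻ y in Ioi (0 : ℝ), P {ω | y < T (τ ω)}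

/-- `T` maximizes the profit among all DIR-compatible cumulative payment functions for `τ`. -/
def IsOptimalPayment {Ω : Type*} [MeasurableSpace Ω] (P : Measure Ω) (τ : Ω → ℝ) (w : ℝ → ℝ)
    (θ lam : ℝ) (T : ℝ → ℝ) : Prop :=
  IsPayment T ∧ DIR P τ w θ lam T ∧
    ∀ T' : ℝ → ℝ, IsPayment T' → DIR P τ w θ lam T' → profit P τ T' ≤ profit P τ T

/-- `g ∈ L¹[0,t₁]` solves
`e^{-t} - w(e^{-t}) - ∫_0^t w(e^{-t+s}) g(s) ds = 0` for all `t ∈ [0,t₁]`. -/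
def SolvesMultiplierEq (w : ℝ → ℝ) (t₁ : ℝ) (g : ℝ → ℝ) : Prop :=
  IntegrableOn g (Icc 0 t₁) ∧ ∀ t ∈ Icc 0 t₁,
    Real.exp (-t) - w (Real.exp (-t)) - ∫ s in 0..t, w (Real.exp (-t + s)) * g s = 0

/-- `f ∈ L¹[0,t₀]` solves
`w(e^{-t₀+t}) + ∫_t^{t₀} w(e^{-s+t}) f(s) ds = 1` for all `t ∈ [0,t₀]`. -/
def SolvesBindingEq (w : ℝ → ℝ) (t₀ : ℝ) (f : ℝ → ℝ) : Prop :=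
  IntegrableOn f (Icc 0 t₀) ∧ ∀ t ∈ Icc 0 t₀,
    w (Real.exp (-t₀ + t)) + ∫ s in t..t₀, w (Real.exp (-s + t)) * f s = 1

/-- `T*(t) = (θ/λ) (1_{t > t₀} + ∫_0^{min(t,t₀)} f(s) ds)`. -/
def starPayment (θ lam t₀ : ℝ) (f : ℝ → ℝ) (t : ℝ) : ℝ :=
  θ / lam * ((if t₀ < t then 1 else 0) + ∫ s in 0..min t t₀, f s)

end

/-! The problem is a linear program in disguise. Cumulative payments increase in time, so given `τ >
s` each event "future payments exceed `y`" is empty or an open half-line in the remaining time, and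
the exponential law is memoryless. If `m` is the payment measure of `T`, the perceived cost at `s`
is therefore `λ ∫ K(x - s) m(dx)`, with `K(u) = w(e^{-u})` for `u ≥ 0` and `K(u) = 0` for `u < 0`;
the profit is `∫ e^{-x} m(dx)`. Both are linear in `m`.

A dual feasible point is a measure `Γ` on `[0,∞)` with `(K * Γ)(x) ≥ e^{-x}`. The choice is `Γ = δ₀
+ g₀ 1_(0,t₀)`: the multiplier equation gives equality on `[0,t₀]`, and beyond `t₀` the inequality
is strict (`exp_neg_lt_kernel_add_integral`). The strictness comes from `w''' > 0`, which puts `w`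
above its quadratic interpolants (`interpolation_lt`), combined with `g₀(t₀) ≤ 0`. Weak duality
bounds every profit. `T*` attains the bound because it pays only on `[0,t₀]`, with all constraints
binding there. Conversely, complementary slackness forces any optimal payment to stop at `t₀` and to
bind at `0` and almost everywhere on `(0,t₀)`, which determines it.

Both integral equations have kernel `K`, the survival function of the probability density `A(u) =
e^{-u} w'(e^{-u})`. Renewal theory solves them: the renewal density `R = A + A * R` satisfies `K + K
* R = 1` on `[0,∞)`, so convolution with `K` can be inverted. Then `f(s) = R(t₀ - s)`, and with
`e(t) = e^{-t}` on `[0,∞)`, `g₀ = R - (e + e * R)`. Convolutions are taken in `[0,∞]`, where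
Tonelli's theorem needs no integrability. Since `w'(1)` may be infinite, `A` may be unbounded at
`0`, and continuity of `R` needs the weighted bound `exists_mul_renewalDensity_le`. -/

open scoped ENNReal

/-! ### Calculus of weighting functions -/

namespace IsWeighting

variable {w : ℝ → ℝ}

theorem hasDerivAt (hw : IsWeighting w) {p : ℝ} (hp : p ∈ Ioo (0 : ℝ) 1) :
    HasDerivAt w (deriv w p) p := by
  simpa using (hw.differentiableAt 0 (by norm_num) p hp).hasDerivAt

theorem hasDerivAt_deriv (hw : IsWeighting w) {p : ℝ} (hp : p ∈ Ioo (0 : ℝ) 1) :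
    HasDerivAt (deriv w) (deriv (deriv w) p) p := by
  simpa [iteratedDeriv_one] using (hw.differentiableAt 1 (by norm_num) p hp).hasDerivAt

theorem hasDerivAt_deriv_deriv (hw : IsWeighting w) {p : ℝ} (hp : p ∈ Ioo (0 : ℝ) 1) :
    HasDerivAt (deriv (deriv w)) (deriv (deriv (deriv w)) p) p := by
  simpa [iteratedDeriv_succ, iteratedDeriv_one] using
    (hw.differentiableAt 2 (by norm_num) p hp).hasDerivAt

theorem deriv_deriv_deriv_pos (hw : IsWeighting w) {p : ℝ} (hp : p ∈ Ioo (0 : ℝ) 1) :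
    0 < deriv (deriv (deriv w)) p := by
  simpa [iteratedDeriv_succ, iteratedDeriv_one] using hw.third_pos p hp

theorem continuousOn_deriv (hw : IsWeighting w) : ContinuousOn (deriv w) (Ioo 0 1) :=
  fun _ hp => (hw.hasDerivAt_deriv hp).continuousAt.continuousWithinAt

theorem strictConvexOn_deriv (hw : IsWeighting w) : StrictConvexOn ℝ (Ioo 0 1) (deriv w) := by
  refine strictConvexOn_of_deriv2_pos (convex_Ioo 0 1) hw.continuousOn_deriv fun x hx => ?_
  rw [interior_Ioo] at hx
  simpa using hw.deriv_deriv_deriv_pos hx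

theorem mapsTo (hw : IsWeighting w) {p : ℝ} (hp : p ∈ Icc (0 : ℝ) 1) : w p ∈ Icc (0 : ℝ) 1 := by
  have h0 := hw.strictMonoOn.monotoneOn (left_mem_Icc.2 zero_le_one) hp hp.1
  have h1 := hw.strictMonoOn.monotoneOn hp (right_mem_Icc.2 zero_le_one) hp.2
  rw [hw.map_zero] at h0
  rw [hw.map_one] at h1
  exact ⟨h0, h1⟩

theorem pos (hw : IsWeighting w) {p : ℝ} (hp : p ∈ Ioc (0 : ℝ) 1) : 0 < w p := by
  have := hw.strictMonoOn (left_mem_Icc.2 zero_le_one) (Ioc_subset_Icc_self hp) hp.1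
  rwa [hw.map_zero] at this

theorem deriv_nonneg (hw : IsWeighting w) {p : ℝ} (hp : p ∈ Ioo (0 : ℝ) 1) : 0 ≤ deriv w p := by
  have hm : MonotoneOn w (Ioo 0 1) := hw.strictMonoOn.monotoneOn.mono Ioo_subset_Icc_self
  have := hm.derivWithin_nonneg (x := p)
  rwa [derivWithin_of_mem_nhds (Ioo_mem_nhds hp.1 hp.2)] at this

/-- A function whose derivative is strictly convex and that vanishes at `0 < p < b` is positive
on `(0, p)`. -/
theorem _root_.pos_of_strictConvexOn_deriv {D D' : ℝ → ℝ} {p q b : ℝ} (hq : 0 < q) (hqp : q < p)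
    (hpb : p < b) (hc : ContinuousOn D (Icc 0 b)) (hD : ∀ x ∈ Ioo 0 b, HasDerivAt D (D' x) x)
    (hD' : StrictConvexOn ℝ (Ioo 0 b) D') (h0 : D 0 = 0) (hp : D p = 0) (hb : D b = 0) :
    0 < D q := by
  -- Rolle gives zeros `x < p < z` of `D'`. By strict convexity `D'` is positive before `x` and
  -- negative between them, so `D` rises from `0` up to `x` and then falls to the value `0` at `p`.
  obtain ⟨x, hx, hx0⟩ := exists_hasDerivAt_eq_zero (hq.trans hqp)
    (hc.mono (Icc_subset_Icc_right hpb.le)) (by rw [h0, hp])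
    (fun y hy => hD y ⟨hy.1, hy.2.trans hpb⟩)
  obtain ⟨z, hz, hz0⟩ := exists_hasDerivAt_eq_zero hpb
    (hc.mono (Icc_subset_Icc_left (hq.trans hqp).le)) (by rw [hp, hb])
    (fun y hy => hD y ⟨(hq.trans hqp).trans hy.1, hy.2⟩)
  have hxb : x ∈ Ioo 0 b := ⟨hx.1, hx.2.trans hpb⟩
  have hzb : z ∈ Ioo 0 b := ⟨(hq.trans hqp).trans hz.1, hz.2⟩
  rcases le_or_gt q x with h | h
  · have hmono : StrictMonoOn D (Icc 0 x) := by
      refine strictMonoOn_of_deriv_pos (convex_Icc 0 x)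
        (hc.mono (Icc_subset_Icc_right hxb.2.le)) fun y hy => ?_
      rw [interior_Icc] at hy
      have hyb : y ∈ Ioo 0 b := ⟨hy.1, hy.2.trans hxb.2⟩
      rw [(hD y hyb).deriv]
      by_contra! hneg
      have := hD'.slope_strict_mono_adjacent hyb hzb hy.2 (hx.2.trans hz.1)
      rw [hx0, hz0, sub_self, zero_div, div_lt_iff₀ (by linarith [hy.2])] at this
      linarith
    have := hmono (left_mem_Icc.2 hx.1.le) ⟨hq.le, h⟩ hq
    rwa [h0] at this
  · have hanti : StrictAntiOn D (Icc x z) := by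
      refine strictAntiOn_of_deriv_neg (convex_Icc x z)
        (hc.mono (Icc_subset_Icc hx.1.le hzb.2.le)) fun y hy => ?_
      rw [interior_Icc] at hy
      have hyb : y ∈ Ioo 0 b := ⟨hx.1.trans hy.1, hy.2.trans hzb.2⟩
      rw [(hD y hyb).deriv]
      by_contra! hneg
      have := hD'.slope_strict_mono_adjacent hxb hzb hy.1 hy.2
      rw [hx0, hz0, div_lt_div_iff₀ (by linarith [hy.1]) (by linarith [hy.2])] at this
      nlinarith [hy.1, hy.2]
    have := hanti ⟨h.le, (hqp.trans hz.1).le⟩ ⟨hx.2.le, hz.1.le⟩ hqp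
    rwa [hp] at this

/-- A weighting function lies above its quadratic interpolant at `0 < p < b` on `(0, p)`. -/
theorem interpolation_lt (hw : IsWeighting w) {p q b : ℝ} (hq : 0 < q) (hqp : q < p)
    (hpb : p < b) (hb : b ≤ 1) :
    q * (b - q) / (p * (b - p)) * w p - q * (p - q) / (b * (b - p)) * w b < w q := by
  have hp0 : 0 < p := hq.trans hqp
  have hb0 : 0 < b := hp0.trans hpb
  have hbp : 0 < b - p := sub_pos.2 hpb
  -- With these constants `x (b - x) α - x (p - x) β` is the quadratic through the graph of `w` at
  -- `0`, `p` and `b`. Subtracting it changes the derivative by an affine function, which preserves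
  -- strict convexity.
  set α : ℝ := w p / (p * (b - p)) with hα
  set β : ℝ := w b / (b * (b - p)) with hβ
  have key := pos_of_strictConvexOn_deriv
    (D := fun x => w x - (x * (b - x) * α - x * (p - x) * β))
    (D' := fun x => deriv w x + ((2 * x - b) * α + (p - 2 * x) * β)) hq hqp hpb ?_ ?_ ?_ ?_ ?_ ?_
  · have : q * (b - q) / (p * (b - p)) * w p - q * (p - q) / (b * (b - p)) * w b
        = q * (b - q) * α - q * (p - q) * β := by
      rw [hα, hβ]; ring
    rw [this]
    linarith
  · refine (hw.continuousOn.mono (Icc_subset_Icc_right hb)).sub (Continuous.continuousOn ?_)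
    fun_prop
  · intro x hx
    have h1 := hw.hasDerivAt ⟨hx.1, hx.2.trans_le hb⟩
    have h2 : HasDerivAt (fun x : ℝ => x * (b - x) * α - x * (p - x) * β)
        ((1 * (b - x) + x * (-1)) * α - (1 * (p - x) + x * (-1)) * β) x :=
      (((hasDerivAt_id x).mul ((hasDerivAt_id x).const_sub b)).mul_const α).sub
        (((hasDerivAt_id x).mul ((hasDerivAt_id x).const_sub p)).mul_const β)
    exact (h1.sub h2).congr_deriv (by ring)
  · refine (hw.strictConvexOn_deriv.subset (Ioo_subset_Ioo_right hb)
      (convex_Ioo 0 b)).add_convexOn ⟨convex_Ioo 0 b, fun x _ y _ s t _ _ hst => le_of_eq ?_⟩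
    simp only [smul_eq_mul]
    have : t = 1 - s := by linarith
    subst this
    ring
  · simp [hw.map_zero]
  · simp only [hα]
    field_simp
    simp
  · simp only [hβ]
    field_simp
    ring

theorem _root_.nhdsWithin_Icc_diff_right : 𝓝[Icc (0 : ℝ) 1 \ {1}] 1 = 𝓝[<] 1 := by
  rw [Icc_sdiff_right, nhdsWithin_Ico_eq_nhdsLT zero_lt_one]

theorem _root_.nhdsWithin_Icc_diff_left : 𝓝[Icc (0 : ℝ) 1 \ {0}] 0 = 𝓝[>] 0 := by
  rw [Icc_sdiff_left, nhdsWithin_Ioc_eq_nhdsGT zero_lt_one]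

theorem exists_lt_id (hw : IsWeighting w) : ∃ p ∈ Ioo (0 : ℝ) 1, w p < p := by
  obtain ⟨d, hd, hd1⟩ := hw.slope_one
  rw [HasExtDerivWithin, nhdsWithin_Icc_diff_right] at hd
  obtain ⟨p, hp, hp1⟩ := ((hd.eventually_const_lt hd1).and
    (Ioo_mem_nhdsLT (zero_lt_one' ℝ))).exists
  refine ⟨p, hp1, ?_⟩
  have h : (1 : ℝ) < slope w 1 p := by exact_mod_cast hp
  rw [slope_def_field, hw.map_one, lt_div_iff_of_neg (by linarith [hp1.2])] at h
  linarith

theorem exists_id_lt (hw : IsWeighting w) : ∃ p ∈ Ioo (0 : ℝ) 1, p < w p := by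
  obtain ⟨d, hd, hd1⟩ := hw.slope_zero
  rw [HasExtDerivWithin, nhdsWithin_Icc_diff_left] at hd
  obtain ⟨p, hp, hp1⟩ := ((hd.eventually_const_lt hd1).and
    (Ioo_mem_nhdsGT (zero_lt_one' ℝ))).exists
  refine ⟨p, hp1, ?_⟩
  have h : (1 : ℝ) < slope w 0 p := by exact_mod_cast hp
  rw [slope_def_field, hw.map_zero, lt_div_iff₀ (by linarith [hp1.1])] at h
  linarith

/-- The inflection point: the derivative decreases before it and increases after it. -/
theorem exists_inflection (hw : IsWeighting w) :
    ∃ m ∈ Ioo (0 : ℝ) 1, AntitoneOn (deriv w) (Ioc 0 m) ∧ MonotoneOn (deriv w) (Ico m 1) := by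
  have hI : (interior (Icc (0 : ℝ) 1)) = Ioo 0 1 := interior_Icc
  have hdw : DifferentiableOn ℝ w (interior (Icc 0 1)) := by
    rw [hI]; exact fun x hx => (hw.hasDerivAt hx).differentiableAt.differentiableWithinAt
  have hddw : DifferentiableOn ℝ (deriv w) (interior (Icc 0 1)) := by
    rw [hI]; exact fun x hx => (hw.hasDerivAt_deriv hx).differentiableAt.differentiableWithinAt
  have hcc : ContinuousOn (deriv (deriv w)) (Ioo 0 1) := fun _ hp =>
    (hw.hasDerivAt_deriv_deriv hp).continuousAt.continuousWithinAt
  have hsm : StrictMonoOn (deriv (deriv w)) (Ioo 0 1) := by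
    refine strictMonoOn_of_deriv_pos (convex_Ioo 0 1) hcc fun x hx => ?_
    rw [interior_Ioo] at hx
    exact hw.deriv_deriv_deriv_pos hx
  -- The strictly increasing `w''` changes sign: a concave `w` would lie above the diagonal, against
  -- the slope at `1`, and a convex one below it, against the slope at `0`.
  have hpos : ∃ x ∈ Ioo (0 : ℝ) 1, 0 < deriv (deriv w) x := by
    by_contra! hcon
    have hconc : ConcaveOn ℝ (Icc 0 1) w := by
      refine concaveOn_of_deriv2_nonpos (convex_Icc 0 1) hw.continuousOn hdw hddw fun x hx => ?_
      rw [hI] at hx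
      exact hcon x hx
    obtain ⟨p, hp, hp1⟩ := hw.exists_lt_id
    have := hconc.2 (left_mem_Icc.2 zero_le_one) (right_mem_Icc.2 zero_le_one)
      (sub_nonneg.2 hp.2.le) hp.1.le (by ring)
    simp only [hw.map_zero, hw.map_one, smul_eq_mul, mul_zero, mul_one, zero_add] at this
    linarith
  have hneg : ∃ x ∈ Ioo (0 : ℝ) 1, deriv (deriv w) x < 0 := by
    by_contra! hcon
    have hconv : ConvexOn ℝ (Icc 0 1) w := by
      refine convexOn_of_deriv2_nonneg (convex_Icc 0 1) hw.continuousOn hdw hddw fun x hx => ?_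
      rw [hI] at hx
      exact hcon x hx
    obtain ⟨p, hp, hp1⟩ := hw.exists_id_lt
    have := hconv.2 (left_mem_Icc.2 zero_le_one) (right_mem_Icc.2 zero_le_one)
      (sub_nonneg.2 hp.2.le) hp.1.le (by ring)
    simp only [hw.map_zero, hw.map_one, smul_eq_mul, mul_zero, mul_one, zero_add] at this
    linarith
  obtain ⟨x, hx, hx0⟩ := hneg
  obtain ⟨y, hy, hy0⟩ := hpos
  obtain ⟨m, hm, hm0⟩ := isPreconnected_Ioo.intermediate_value hx hy hcc ⟨hx0.le, hy0.le⟩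
  refine ⟨m, hm, ?_, ?_⟩
  · refine antitoneOn_of_deriv_nonpos (convex_Ioc 0 m)
      (hw.continuousOn_deriv.mono fun z hz => ⟨hz.1, hz.2.trans_lt hm.2⟩) ?_ ?_
    · rw [interior_Ioc]
      exact hddw.mono (by rw [hI]; exact Ioo_subset_Ioo_right hm.2.le)
    · rw [interior_Ioc]
      intro z hz
      exact (hsm ⟨hz.1, hz.2.trans hm.2⟩ hm hz.2).le.trans hm0.le
  · refine monotoneOn_of_deriv_nonneg (convex_Ico m 1)
      (hw.continuousOn_deriv.mono fun z hz => ⟨hm.1.trans_le hz.1, hz.2⟩) ?_ ?_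
    · rw [interior_Ico]
      exact hddw.mono (by rw [hI]; exact Ioo_subset_Ioo_left hm.1.le)
    · rw [interior_Ico]
      intro z hz
      exact hm0.symm.le.trans (hsm hm ⟨hm.1.trans hz.1, hz.2⟩ hz.1).le

theorem exists_deriv_eq_div (hw : IsWeighting w) {x y : ℝ} (hx : 0 ≤ x) (hxy : x < y)
    (hy : y ≤ 1) : ∃ c ∈ Ioo x y, deriv w c = (w y - w x) / (y - x) :=
  exists_hasDerivAt_eq_slope w (deriv w) hxy (hw.continuousOn.mono (Icc_subset_Icc hx hy))
    fun _ hz => hw.hasDerivAt ⟨hx.trans_lt hz.1, hz.2.trans_le hy⟩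

/-- Before the inflection point `w'(p)` is at most the slope of the chord from `0` to `p`; after it,
at most that of the chord from `p` to `1`. Neither chord rises by more than `1`. This controls `w'`
even when the end-point slopes are infinite. -/
theorem mul_deriv_le (hw : IsWeighting w) {p : ℝ} (hp : p ∈ Ioo (0 : ℝ) 1) :
    p * deriv w p ≤ 1 ∨ (1 - p) * deriv w p ≤ 1 := by
  obtain ⟨m, hm, hanti, hmono⟩ := hw.exists_inflection
  have hwp := hw.mapsTo (Ioo_subset_Icc_self hp)
  rcases le_total p m with h | h
  · left
    obtain ⟨c, hc, hc'⟩ := hw.exists_deriv_eq_div le_rfl hp.1 hp.2.le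
    have := hanti ⟨hc.1, hc.2.le.trans h⟩ ⟨hp.1, h⟩ hc.2.le
    rw [hc', hw.map_zero, sub_zero, sub_zero, le_div_iff₀ hp.1] at this
    linarith [hwp.2]
  · right
    obtain ⟨c, hc, hc'⟩ := hw.exists_deriv_eq_div hp.1.le hp.2 le_rfl
    have := hmono ⟨h, hp.2⟩ ⟨h.trans hc.1.le, hc.2⟩ hc.1.le
    rw [hc', hw.map_one, le_div_iff₀ (sub_pos.2 hp.2)] at this
    linarith [hwp.1]

/-- The derivative tends to the end-point slope at `1`. -/
theorem tendsto_deriv (hw : IsWeighting w) {d : EReal} (hd : HasExtDerivWithin w (Icc 0 1) 1 d) :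
    Tendsto (fun p => ((deriv w p : ℝ) : EReal)) (𝓝[<] 1) (𝓝 d) := by
  obtain ⟨m, hm, -, hmono⟩ := hw.exists_inflection
  rw [HasExtDerivWithin, nhdsWithin_Icc_diff_right] at hd
  rw [tendsto_order]
  constructor
  · intro e he
    -- Lower bound: fix a chord from `x` to `1` steeper than `e`. The chords from `x` to `p`
    -- approach it as `p → 1`, and past the inflection point `w'(p)` dominates their slopes.
    obtain ⟨x, hx, hx1⟩ := ((hd.eventually_const_lt he).and (Ioo_mem_nhdsLT hm.2)).exists
    have hc : Tendsto (fun p => (((w p - w x) / (p - x) : ℝ) : EReal)) (𝓝[<] 1)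
        (𝓝 ((slope w 1 x : ℝ) : EReal)) := by
      refine (continuous_coe_real_ereal.tendsto _).comp ?_
      have h1 : Tendsto w (𝓝[<] 1) (𝓝 (w 1)) := by
        have := (hw.continuousOn 1 (right_mem_Icc.2 zero_le_one)).tendsto
        rw [nhdsWithin_Icc_eq_nhdsLE zero_lt_one] at this
        exact this.mono_left (nhdsWithin_mono _ Iio_subset_Iic_self)
      have h2 : Tendsto (fun p : ℝ => p - x) (𝓝[<] 1) (𝓝 (1 - x)) :=
        ((continuous_id.sub continuous_const).tendsto 1).mono_left nhdsWithin_le_nhds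
      have := (h1.sub_const (w x)).div h2 (by linarith [hx1.2])
      rw [slope_def_field, ← neg_div_neg_eq, neg_sub, neg_sub]
      exact this
    filter_upwards [hc.eventually_const_lt hx, Ioo_mem_nhdsLT hx1.2] with p hp hp1
    obtain ⟨c, hc, hc'⟩ := hw.exists_deriv_eq_div (hm.1.trans hx1.1).le hp1.1 hp1.2.le
    rw [← hc'] at hp
    refine hp.trans_le (EReal.coe_le_coe_iff.2 (hmono ?_ ?_ hc.2.le))
    · exact ⟨(hx1.1.trans hc.1).le, hc.2.trans hp1.2⟩
    · exact ⟨(hx1.1.trans hp1.1).le, hp1.2⟩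
  · intro e he
    -- Upper bound: past the inflection point `w'(p)` is at most the slope of the chord from `p` to
    -- `1`.
    filter_upwards [hd.eventually_lt_const he, Ioo_mem_nhdsLT hm.2] with p hp hp1
    refine lt_of_le_of_lt (EReal.coe_le_coe_iff.2 ?_) hp
    obtain ⟨c, hc, hc'⟩ := hw.exists_deriv_eq_div (hm.1.trans hp1.1).le hp1.2 le_rfl
    rw [slope_def_field, ← neg_div_neg_eq, neg_sub, neg_sub, ← hc']
    exact hmono ⟨hp1.1.le, hp1.2⟩ ⟨(hp1.1.trans hc.1).le, hc.2⟩ hc.1.le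

/-- If `p` is a fixed point, the quadratic interpolating `w` at `0`, `p`, `1` is the identity, so
`w(q) > q` for all `q < p` and no smaller fixed point exists. Existence is the intermediate value
theorem between points on either side of the diagonal. -/
theorem existsUnique_fixedPoint (hw : IsWeighting w) :
    ∃ p₁, p₁ ∈ Ioo (0 : ℝ) 1 ∧ w p₁ = p₁ ∧ ∀ p ∈ Ioo (0 : ℝ) 1, w p = p → p = p₁ := by
  have hlt : ∀ p ∈ Ioo (0 : ℝ) 1, ∀ q ∈ Ioo (0 : ℝ) 1, w p = p → w q = q → ¬ q < p := by
    intro p hp q hq hwp hwq hqp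
    have := hw.interpolation_lt hq.1 hqp hp.2 le_rfl
    have h1 : 1 - p ≠ 0 := (sub_pos.2 hp.2).ne'
    have h2 : q * (1 - q) / (p * (1 - p)) * p - q * (p - q) / (1 * (1 - p)) * 1 = q := by
      have := hp.1.ne'
      field_simp
      ring
    rw [hwp, hw.map_one, hwq, h2] at this
    exact this.false
  obtain ⟨x, hx, hx'⟩ := hw.exists_id_lt
  obtain ⟨y, hy, hy'⟩ := hw.exists_lt_id
  have hc : ContinuousOn (fun p => w p - p) (Ioo 0 1) :=
    (hw.continuousOn.mono Ioo_subset_Icc_self).sub continuousOn_id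
  obtain ⟨p, hp, hp'⟩ := isPreconnected_Ioo.intermediate_value hy hx hc
    (show (0 : ℝ) ∈ Icc _ _ from ⟨by linarith, by linarith⟩)
  refine ⟨p, hp, by simpa [sub_eq_zero] using hp', fun q hq hwq => ?_⟩
  have hwp : w p = p := by simpa [sub_eq_zero] using hp'
  exact le_antisymm (not_lt.1 (hlt q hq p hp hwq hwp)) (not_lt.1 (hlt p hp q hq hwp hwq))

end IsWeighting

/-! ### Convolution of measures with nonnegative functions -/

/-- The convolution `∫ f(t - x) μ(dx)` of a measure with a nonnegative function. -/
noncomputable def mconv (μ : Measure ℝ) (f : ℝ → ℝ≥0∞) (t : ℝ) : ℝ≥0∞ := ∫⁻ x, f (t - x) ∂μ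

section mconv

variable {μ ν : Measure ℝ} {f g : ℝ → ℝ≥0∞}

theorem measurable_mconv [SFinite μ] (hf : Measurable f) : Measurable (mconv μ f) :=
  Measurable.lintegral_prod_right' (f := fun z : ℝ × ℝ => f (z.1 - z.2))
    (hf.comp (measurable_fst.sub measurable_snd))

theorem mconv_add (hf : Measurable f) (t : ℝ) :
    mconv μ (fun s => f s + g s) t = mconv μ f t + mconv μ g t :=
  lintegral_add_left (hf.comp (measurable_const.sub measurable_id)) _

theorem mconv_mono (hfg : f ≤ g) (t : ℝ) : mconv μ f t ≤ mconv μ g t :=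
  lintegral_mono fun _ => hfg _

theorem mconv_iSup {f : ℕ → ℝ → ℝ≥0∞} (hf : ∀ n, Measurable (f n)) (hmono : Monotone f) (t : ℝ) :
    mconv μ (fun s => ⨆ n, f n s) t = ⨆ n, mconv μ (f n) t :=
  lintegral_iSup (fun n => (hf n).comp (measurable_const.sub measurable_id))
    fun _ _ hmn _ => hmono hmn _

theorem mconv_comm [SFinite μ] [SFinite ν] (hf : Measurable f) (t : ℝ) :
    mconv μ (mconv ν f) t = mconv ν (mconv μ f) t := by
  unfold mconv
  rw [lintegral_lintegral_swap]
  · simp only [sub_right_comm]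
  · exact (hf.comp ((measurable_const.sub measurable_fst).sub measurable_snd)).aemeasurable

theorem mconv_withDensity (hg : Measurable g) (hf : Measurable f) (t : ℝ) :
    mconv (volume.withDensity g) f t = ∫⁻ x, g x * f (t - x) :=
  lintegral_withDensity_eq_lintegral_mul _ hg (hf.comp (measurable_const.sub measurable_id))

theorem mconv_withDensity_comm (hg : Measurable g) (hf : Measurable f) (t : ℝ) :
    mconv (volume.withDensity g) f t = mconv (volume.withDensity f) g t := by
  rw [mconv_withDensity hg hf, mconv_withDensity hf hg,
    ← lintegral_sub_left_eq_self (fun x => f x * g (t - x)) t]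
  simp only [sub_sub_cancel, mul_comm]

theorem mconv_withDensity_mconv [SFinite μ] (hf : Measurable f) (hg : Measurable g) (t : ℝ) :
    mconv (volume.withDensity (mconv μ f)) g t = mconv μ (mconv (volume.withDensity f) g) t := by
  rw [mconv_withDensity_comm (measurable_mconv hf) hg, mconv_comm hf]
  exact congrFun (congrArg _ (funext fun s => mconv_withDensity_comm hg hf s)) t

theorem withDensity_add_mconv (hf : Measurable f) (t : ℝ) {h : ℝ → ℝ≥0∞} :
    mconv (volume.withDensity (fun s => f s + g s)) h t
      = mconv (volume.withDensity f) h t + mconv (volume.withDensity g) h t := by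
  have : volume.withDensity (fun s => f s + g s)
      = volume.withDensity f + volume.withDensity g := withDensity_add_left hf g
  rw [mconv, this, lintegral_add_measure]
  rfl

/-- The Laplace transform at `1` turns convolution into a product, since `e^{-t} = e^{-x}
e^{-(t-x)}`. -/
theorem lintegral_exp_mul_mconv [SFinite μ] (hf : Measurable f) :
    ∫⁻ t, ENNReal.ofReal (Real.exp (-t)) * mconv μ f t
      = (∫⁻ x, ENNReal.ofReal (Real.exp (-x)) ∂μ)
        * ∫⁻ t, ENNReal.ofReal (Real.exp (-t)) * f t := by
  have he : Measurable fun t : ℝ => ENNReal.ofReal (Real.exp (-t)) := by fun_prop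
  unfold mconv
  have h1 : ∀ t, ENNReal.ofReal (Real.exp (-t)) * ∫⁻ x, f (t - x) ∂μ
      = ∫⁻ x, ENNReal.ofReal (Real.exp (-t)) * f (t - x) ∂μ := fun t =>
    (lintegral_const_mul _ (hf.comp (measurable_const.sub measurable_id))).symm
  simp only [h1]
  rw [lintegral_lintegral_swap, ← lintegral_mul_const _ he]
  · refine lintegral_congr fun x => ?_
    rw [← lintegral_const_mul _ (he.fun_mul hf),
      ← lintegral_sub_right_eq_self (fun t => _ * (_ * f t)) x]
    refine lintegral_congr fun t => ?_
    rw [← mul_assoc, ← ENNReal.ofReal_mul (Real.exp_pos _).le, ← Real.exp_add]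
    congr 4
    ring
  · exact ((he.comp measurable_fst).mul
      (hf.comp (measurable_fst.sub measurable_snd))).aemeasurable

end mconv

/-! ### The renewal equation -/

/-- `L = c / (1 - q)` is the fixed point of `x ↦ c + q x`. A bound by `L` thus propagates along the
renewal iterates. -/
theorem ENNReal.exists_add_mul_le {c q : ℝ≥0∞} (hc : c ≠ ∞) (hq : q < 1) :
    ∃ L, L ≠ ∞ ∧ c + q * L ≤ L := by
  have hq' : q ≠ ∞ := (hq.trans ENNReal.one_lt_top).ne
  lift c to NNReal using hc
  lift q to NNReal using hq'
  have hq1 : (q : ℝ) < 1 := by exact_mod_cast hq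
  have h1 : 0 < 1 - (q : ℝ) := sub_pos.2 hq1
  refine ⟨ENNReal.ofReal (c / (1 - q)), ENNReal.ofReal_ne_top, ?_⟩
  rw [← ENNReal.ofReal_coe_nnreal, ← ENNReal.ofReal_coe_nnreal,
    ← ENNReal.ofReal_mul (NNReal.coe_nonneg q),
    ← ENNReal.ofReal_add (NNReal.coe_nonneg c)
      (mul_nonneg (NNReal.coe_nonneg q) (div_nonneg (NNReal.coe_nonneg c) h1.le))]
  refine ENNReal.ofReal_le_ofReal (le_of_eq ?_)
  field_simp
  ring

/-- The iterates `S₀ = 0`, `Sₙ₊₁ = A + A * Sₙ` of the renewal equation. -/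
noncomputable def renewalSeq (A : ℝ → ℝ≥0∞) : ℕ → ℝ → ℝ≥0∞
  | 0 => fun _ => 0
  | n + 1 => fun t => A t + mconv (volume.withDensity A) (renewalSeq A n) t

/-- The renewal density of `A`: the minimal solution of `R = A + A * R`. -/
noncomputable def renewalDensity (A : ℝ → ℝ≥0∞) (t : ℝ) : ℝ≥0∞ := ⨆ n, renewalSeq A n t

/-- Probability densities on `(0, ∞)`. -/
structure IsDelayDensity (A : ℝ → ℝ≥0∞) : Prop where
  measurable : Measurable A
  eq_zero : ∀ t ≤ 0, A t = 0
  lintegral_eq_one : ∫⁻ t, A t = 1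

namespace IsDelayDensity

variable {A : ℝ → ℝ≥0∞}

theorem measurable_renewalSeq (hA : IsDelayDensity A) (n : ℕ) : Measurable (renewalSeq A n) := by
  induction n with
  | zero => exact measurable_const
  | succ n ih => exact hA.measurable.add (measurable_mconv ih)

theorem monotone_renewalSeq (A : ℝ → ℝ≥0∞) : Monotone (renewalSeq A) := by
  refine monotone_nat_of_le_succ fun n => ?_
  induction n with
  | zero => exact fun _ => zero_le
  | succ n ih => exact fun t => add_le_add le_rfl (mconv_mono ih t)

theorem measurable_renewalDensity (hA : IsDelayDensity A) : Measurable (renewalDensity A) :=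
  Measurable.iSup hA.measurable_renewalSeq

theorem renewalDensity_eq (hA : IsDelayDensity A) (t : ℝ) :
    renewalDensity A t = A t + mconv (volume.withDensity A) (renewalDensity A) t := by
  have h1 : renewalDensity A t = ⨆ n, renewalSeq A (n + 1) t :=
    (Monotone.iSup_nat_add (f := fun n => renewalSeq A n t)
      (fun _ _ h => monotone_renewalSeq A h t) 1).symm
  have h2 : mconv (volume.withDensity A) (renewalDensity A) t
      = ⨆ n, mconv (volume.withDensity A) (renewalSeq A n) t :=
    mconv_iSup hA.measurable_renewalSeq (monotone_renewalSeq A) t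
  rw [h1, h2, ENNReal.add_iSup]
  rfl

theorem mconv_eq_zero (hA : IsDelayDensity A) {f : ℝ → ℝ≥0∞} (hf : Measurable f)
    (hf0 : ∀ t < 0, f t = 0) {t : ℝ} (ht : t ≤ 0) : mconv (volume.withDensity A) f t = 0 := by
  rw [mconv_withDensity hA.measurable hf]
  refine (lintegral_congr fun x => ?_).trans lintegral_zero
  rcases le_or_gt x 0 with hx | hx
  · rw [hA.eq_zero x hx, zero_mul]
  · rw [hf0 _ (by linarith), mul_zero]

theorem renewalSeq_eq_zero (hA : IsDelayDensity A) (n : ℕ) {t : ℝ} (ht : t ≤ 0) :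
    renewalSeq A n t = 0 := by
  induction n generalizing t with
  | zero => rfl
  | succ n ih =>
    change A t + _ = 0
    rw [hA.eq_zero t ht, zero_add]
    exact hA.mconv_eq_zero (hA.measurable_renewalSeq n) (fun s hs => ih hs.le) ht

theorem renewalDensity_eq_zero (hA : IsDelayDensity A) {t : ℝ} (ht : t ≤ 0) :
    renewalDensity A t = 0 := by
  simp [renewalDensity, hA.renewalSeq_eq_zero _ ht]

/-- The delay is almost surely positive, so `e^{-x} < 1` almost surely. This integral is the
contraction factor `q` of the bounds below. -/
theorem lintegral_exp_lt_one (hA : IsDelayDensity A) :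
    ∫⁻ x, ENNReal.ofReal (Real.exp (-x)) ∂(volume.withDensity A) < 1 := by
  have h1 : volume.withDensity A univ = 1 := by simp [hA.lintegral_eq_one]
  have hp : IsProbabilityMeasure (volume.withDensity A) := ⟨h1⟩
  have hpos : ∀ᵐ x ∂(volume.withDensity A), 0 < x := by
    rw [ae_withDensity_iff hA.measurable]
    filter_upwards with x hx
    by_contra! h
    exact hx (hA.eq_zero x h)
  have hlt : ∀ᵐ x ∂(volume.withDensity A), ENNReal.ofReal (Real.exp (-x)) < 1 := by
    filter_upwards [hpos] with x hx
    rw [ENNReal.ofReal_lt_one, Real.exp_lt_one_iff]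
    linarith
  have := lintegral_strict_mono (μ := volume.withDensity A) (f := fun x : ℝ =>
    ENNReal.ofReal (Real.exp (-x))) (g := fun _ => 1) (IsProbabilityMeasure.ne_zero _)
    aemeasurable_const ?_ hlt
  · simpa [h1] using this
  · refine ((lintegral_mono_ae (hlt.mono fun x hx => hx.le)).trans_lt ?_).ne
    simp [h1]

/-- Weighted by `e^{-t}`, the mass of `Sₙ₊₁` is `q + q` times that of `Sₙ`. A bound `L ≥ q + q L`
therefore holds for all iterates and passes to the supremum. -/
theorem exists_lintegral_renewalDensity_le (hA : IsDelayDensity A) :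
    ∃ L, L ≠ ∞ ∧ (∀ n, ∫⁻ t, ENNReal.ofReal (Real.exp (-t)) * renewalSeq A n t ≤ L) ∧
      ∫⁻ t, ENNReal.ofReal (Real.exp (-t)) * renewalDensity A t ≤ L := by
  have he : Measurable fun t : ℝ => ENNReal.ofReal (Real.exp (-t)) := by fun_prop
  have hq := hA.lintegral_exp_lt_one
  have hq' : ∫⁻ x, ENNReal.ofReal (Real.exp (-x)) * A x
      = ∫⁻ x, ENNReal.ofReal (Real.exp (-x)) ∂(volume.withDensity A) := by
    rw [lintegral_withDensity_eq_lintegral_mul _ hA.measurable he]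
    simp only [Pi.mul_apply, mul_comm]
  obtain ⟨L, hL, hLq⟩ := ENNReal.exists_add_mul_le (hq.trans ENNReal.one_lt_top).ne hq
  have hn : ∀ n, ∫⁻ t, ENNReal.ofReal (Real.exp (-t)) * renewalSeq A n t ≤ L := by
    intro n
    induction n with
    | zero => simp [renewalSeq]
    | succ n ih =>
      simp only [renewalSeq, mul_add]
      rw [lintegral_add_left (he.fun_mul hA.measurable), hq',
        lintegral_exp_mul_mconv (hA.measurable_renewalSeq n)]
      exact (add_le_add le_rfl (mul_le_mul_right ih _)).trans hLq
  refine ⟨L, hL, hn, ?_⟩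
  simp only [renewalDensity, ENNReal.mul_iSup]
  rw [lintegral_iSup (fun n => he.fun_mul (hA.measurable_renewalSeq n))
    (fun m n hmn t => mul_le_mul_right (monotone_renewalSeq A hmn t) _)]
  exact iSup_le hn

theorem setLIntegral_renewalDensity_lt_top (hA : IsDelayDensity A) (T : ℝ) :
    ∫⁻ t in Iic T, renewalDensity A t < ∞ := by
  obtain ⟨L, hL, -, hL'⟩ := hA.exists_lintegral_renewalDensity_le
  have hm : Measurable fun t => ENNReal.ofReal (Real.exp (-t)) * renewalDensity A t :=
    (by fun_prop : Measurable fun t : ℝ => ENNReal.ofReal (Real.exp (-t))).fun_mul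
      hA.measurable_renewalDensity
  calc ∫⁻ t in Iic T, renewalDensity A t
      ≤ ∫⁻ t in Iic T, ENNReal.ofReal (Real.exp T) *
          (ENNReal.ofReal (Real.exp (-t)) * renewalDensity A t) := by
        refine setLIntegral_mono (measurable_const.fun_mul hm) fun t ht => ?_
        rw [← mul_assoc, ← ENNReal.ofReal_mul (Real.exp_pos _).le, ← Real.exp_add]
        refine le_mul_of_one_le_left zero_le ?_
        rw [ENNReal.one_le_ofReal, Real.one_le_exp_iff]
        linarith [mem_Iic.1 ht]
    _ ≤ ENNReal.ofReal (Real.exp T) * L := by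
        rw [lintegral_const_mul _ hm]
        exact mul_le_mul_right ((setLIntegral_le_lintegral _ _).trans hL') _
    _ < ∞ := ENNReal.mul_lt_top ENNReal.ofReal_lt_top hL.lt_top

/-- In the weighted supremum of `t e^{-t} Sₙ(t)`, the factor `t` is split over the convolution as `x
+ (t - x)`. The `x` goes to `A`, where `x e^{-x} A(x) ≤ 1` leaves the weighted mass of `Sₙ`, at most
`L`; the `t - x` goes to `Sₙ`, which gives `q B` by induction. So `B` is chosen with `1 + L + q B ≤
B`. -/
theorem exists_mul_renewalDensity_le (hA : IsDelayDensity A)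
    (hb : ∀ t, ENNReal.ofReal t * (ENNReal.ofReal (Real.exp (-t)) * A t) ≤ 1) :
    ∃ B, B ≠ ∞ ∧
      ∀ t, ENNReal.ofReal t * (ENNReal.ofReal (Real.exp (-t)) * renewalDensity A t) ≤ B := by
  have he : Measurable fun t : ℝ => ENNReal.ofReal (Real.exp (-t)) := by fun_prop
  obtain ⟨L, hL, hLn, -⟩ := hA.exists_lintegral_renewalDensity_le
  obtain ⟨B, hB, hBq⟩ := ENNReal.exists_add_mul_le (c := 1 + L) (by simp [hL])
    hA.lintegral_exp_lt_one
  refine ⟨B, hB, ?_⟩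
  suffices h : ∀ n t, ENNReal.ofReal t * (ENNReal.ofReal (Real.exp (-t)) * renewalSeq A n t)
      ≤ B by
    intro t
    simp only [renewalDensity, ENNReal.mul_iSup]
    exact iSup_le fun n => h n t
  intro n
  induction n with
  | zero => simp [renewalSeq]
  | succ n ih =>
    intro t
    have hS := hA.measurable_renewalSeq n
    have hS' : Measurable fun x => renewalSeq A n (t - x) :=
      hS.comp (measurable_const.sub measurable_id)
    have he' : Measurable fun x => ENNReal.ofReal (Real.exp (-(t - x))) :=
      he.comp (measurable_const.sub measurable_id)
    have key : ENNReal.ofReal t * (ENNReal.ofReal (Real.exp (-t)) *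
        mconv (volume.withDensity A) (renewalSeq A n) t)
        ≤ L + (∫⁻ x, ENNReal.ofReal (Real.exp (-x)) ∂(volume.withDensity A)) * B := by
      rw [mconv_withDensity hA.measurable hS, ← mul_assoc,
        ← lintegral_const_mul _ (hA.measurable.fun_mul hS')]
      calc ∫⁻ x, ENNReal.ofReal t * ENNReal.ofReal (Real.exp (-t)) *
              (A x * renewalSeq A n (t - x))
          ≤ ∫⁻ x, (ENNReal.ofReal (Real.exp (-(t - x))) * renewalSeq A n (t - x) +
              A x * (ENNReal.ofReal (Real.exp (-x)) * B)) := by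
            refine lintegral_mono fun x => ?_
            have hee : ENNReal.ofReal (Real.exp (-t))
                = ENNReal.ofReal (Real.exp (-x)) * ENNReal.ofReal (Real.exp (-(t - x))) := by
              rw [← ENNReal.ofReal_mul (Real.exp_pos _).le, ← Real.exp_add]
              congr 2
              ring
            have ht : ENNReal.ofReal t ≤ ENNReal.ofReal x + ENNReal.ofReal (t - x) := by
              simpa using ENNReal.ofReal_add_le (p := x) (q := t - x)
            calc ENNReal.ofReal t * ENNReal.ofReal (Real.exp (-t)) *
                  (A x * renewalSeq A n (t - x))
                ≤ (ENNReal.ofReal x + ENNReal.ofReal (t - x)) * ENNReal.ofReal (Real.exp (-t)) *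
                  (A x * renewalSeq A n (t - x)) := by gcongr
              _ = (ENNReal.ofReal x * (ENNReal.ofReal (Real.exp (-x)) * A x)) *
                    (ENNReal.ofReal (Real.exp (-(t - x))) * renewalSeq A n (t - x)) +
                  A x * (ENNReal.ofReal (Real.exp (-x)) * (ENNReal.ofReal (t - x) *
                    (ENNReal.ofReal (Real.exp (-(t - x))) * renewalSeq A n (t - x)))) := by
                  rw [hee]; ring
              _ ≤ _ := by
                  refine add_le_add (mul_le_of_le_one_left zero_le (hb x)) ?_
                  gcongr
                  exact ih (t - x)
        _ ≤ _ := by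
            rw [lintegral_add_left (he'.fun_mul hS')]
            refine add_le_add ?_ (le_of_eq ?_)
            · refine le_trans (le_of_eq ?_) (hLn n)
              exact lintegral_sub_left_eq_self
                (fun x => ENNReal.ofReal (Real.exp (-x)) * renewalSeq A n x) t
            · rw [lintegral_withDensity_eq_lintegral_mul _ hA.measurable he,
                ← lintegral_mul_const _ (hA.measurable.mul he)]
              simp only [Pi.mul_apply, mul_assoc]
    change ENNReal.ofReal t * (ENNReal.ofReal (Real.exp (-t)) * (A t + _)) ≤ B
    rw [mul_add, mul_add]
    refine (add_le_add (hb t) key).trans ?_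
    rwa [← add_assoc]

end IsDelayDensity

/-! ### Finiteness and continuity of the renewal density -/

theorem ENNReal.le_of_mul_exp_neg_mul_le {B c : ℝ≥0∞} {t η T : ℝ} (hη : 0 < η) (ht : η ≤ t)
    (htT : t ≤ T) (h : ENNReal.ofReal t * (ENNReal.ofReal (Real.exp (-t)) * c) ≤ B) :
    c ≤ ENNReal.ofReal (Real.exp T / η) * B := by
  have ht0 : 0 < t := hη.trans_le ht
  calc c = ENNReal.ofReal (Real.exp t / t) *
        (ENNReal.ofReal t * (ENNReal.ofReal (Real.exp (-t)) * c)) := by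
        rw [← mul_assoc, ← mul_assoc, ← ENNReal.ofReal_mul (by positivity),
          ← ENNReal.ofReal_mul (by positivity)]
        have : Real.exp t / t * t * Real.exp (-t) = 1 := by
          rw [div_mul_cancel₀ _ ht0.ne', ← Real.exp_add, add_neg_cancel, Real.exp_zero]
        rw [this, ENNReal.ofReal_one, one_mul]
    _ ≤ ENNReal.ofReal (Real.exp T / η) * B := by
        gcongr

namespace IsDelayDensity

variable {A : ℝ → ℝ≥0∞}

theorem renewalDensity_ne_top (hA : IsDelayDensity A)
    (hb : ∀ t, ENNReal.ofReal t * (ENNReal.ofReal (Real.exp (-t)) * A t) ≤ 1) (t : ℝ) :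
    renewalDensity A t ≠ ∞ := by
  rcases le_or_gt t 0 with ht | ht
  · simp [hA.renewalDensity_eq_zero ht]
  · obtain ⟨B, hB, hBt⟩ := hA.exists_mul_renewalDensity_le hb
    exact ((ENNReal.le_of_mul_exp_neg_mul_le ht le_rfl le_rfl (hBt t)).trans_lt
      (ENNReal.mul_lt_top ENNReal.ofReal_lt_top hB.lt_top)).ne

/-- Cut off below `η`, the density `A` is bounded on bounded sets and jumps only at `η`, which
affects the single point `y = t - η`. Dominated convergence applies because `R` is locally
integrable. -/
theorem continuousAt_mconv_indicator (hA : IsDelayDensity A) (hAc : ContinuousOn A (Ioi 0))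
    (hb : ∀ t, ENNReal.ofReal t * (ENNReal.ofReal (Real.exp (-t)) * A t) ≤ 1) {η : ℝ}
    (hη : 0 < η) (t : ℝ) :
    ContinuousAt (mconv (volume.withDensity (renewalDensity A)) ((Ici η).indicator A)) t := by
  have hR := hA.measurable_renewalDensity
  have hA2 : Measurable ((Ici η).indicator A) := hA.measurable.indicator measurableSet_Ici
  have hsub : ∀ s : ℝ, Measurable fun y => (Ici η).indicator A (s - y) := fun s =>
    hA2.comp (measurable_const.sub measurable_id)
  have hform : mconv (volume.withDensity (renewalDensity A)) ((Ici η).indicator A)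
      = fun s => ∫⁻ y, renewalDensity A y * (Ici η).indicator A (s - y) :=
    funext fun s => mconv_withDensity hR hA2 s
  rw [hform]
  set C : ℝ≥0∞ := ENNReal.ofReal (Real.exp (t + 1) / η) * 1
  refine tendsto_lintegral_filter_of_dominated_convergence
    ((Iic (t + 1)).indicator fun y => renewalDensity A y * C)
    (Eventually.of_forall fun s => hR.mul (hsub s)) ?_ ?_ ?_
  · filter_upwards [Iio_mem_nhds (lt_add_one t)] with s hs
    refine Eventually.of_forall fun y => ?_
    rcases le_or_gt y 0 with hy | hy
    · simp [hA.renewalDensity_eq_zero hy]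
    rcases le_or_gt η (s - y) with h | h
    · rw [indicator_of_mem (mem_Ici.2 h),
        indicator_of_mem (mem_Iic.2 (by linarith [mem_Iio.1 hs]))]
      gcongr
      exact ENNReal.le_of_mul_exp_neg_mul_le hη h (by linarith [mem_Iio.1 hs]) (hb _)
    · rw [indicator_of_notMem (by simpa using h), mul_zero]
      exact zero_le
  · rw [lintegral_indicator measurableSet_Iic, lintegral_mul_const _ hR]
    exact (ENNReal.mul_lt_top (hA.setLIntegral_renewalDensity_lt_top _)
      (ENNReal.mul_lt_top ENNReal.ofReal_lt_top ENNReal.one_lt_top)).ne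
  · have hne : ∀ᵐ y : ℝ, y ≠ t - η := by simp [ae_iff]
    filter_upwards [hne] with y hy
    refine ENNReal.Tendsto.const_mul ?_ (Or.inr (hA.renewalDensity_ne_top hb y))
    have hs : Tendsto (fun s : ℝ => s - y) (𝓝 t) (𝓝 (t - y)) :=
      (continuous_id.sub continuous_const).tendsto t
    rcases lt_or_gt_of_ne (show t - y ≠ η from fun h => hy (by linarith)) with h | h
    · rw [indicator_of_notMem (by simpa using h)]
      refine tendsto_const_nhds.congr' ?_
      filter_upwards [hs (Iio_mem_nhds h)] with s hs
      exact (indicator_of_notMem (notMem_Ici.2 hs) _).symm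
    · rw [indicator_of_mem (mem_Ici.2 h.le)]
      refine ((hAc.continuousAt (Ioi_mem_nhds (hη.trans h))).tendsto.comp hs).congr' ?_
      filter_upwards [hs (Ioi_mem_nhds h)] with s hs
      exact (indicator_of_mem (mem_Ici.2 (show η < s - y from hs).le) _).symm

/-- `A` may blow up at `0`, so `A * R` is split at a small delay `η`. Short delays meet `R` only
away from `0`, where it is bounded, and carry little mass of `A`; their share is small uniformly
near `t`. The share of delays at least `η` is continuous. -/
theorem continuousOn_renewalDensity (hA : IsDelayDensity A) (hAc : ContinuousOn A (Ioi 0))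
    (hb : ∀ t, ENNReal.ofReal t * (ENNReal.ofReal (Real.exp (-t)) * A t) ≤ 1) :
    ContinuousOn (renewalDensity A) (Ioi 0) := by
  have hR := hA.measurable_renewalDensity
  suffices h : ∀ t, 0 < t →
      ContinuousAt (mconv (volume.withDensity A) (renewalDensity A)) t by
    refine fun t ht => ContinuousAt.continuousWithinAt ?_
    rw [show renewalDensity A = fun t => A t + mconv (volume.withDensity A) (renewalDensity A) t
      from funext hA.renewalDensity_eq]
    exact (hAc.continuousAt (Ioi_mem_nhds ht)).add (h t ht)
  intro t ht
  have hfin : mconv (volume.withDensity A) (renewalDensity A) t ≠ ∞ := by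
    have h := hA.renewalDensity_ne_top hb t
    rw [hA.renewalDensity_eq] at h
    exact (ENNReal.add_ne_top.1 h).2
  obtain ⟨B, hB, hBt⟩ := hA.exists_mul_renewalDensity_le hb
  refine (ENNReal.tendsto_nhds hfin).2 fun ε hε => ?_
  -- `C` bounds `R` on `[t/4, t+1]`, which contains `s - x` for `s` in `(t/2, t+1)` and `x` in `(0,
  -- η)`, as `η ≤ t/4`. The mass of `A` on `(0, η)` is then made smaller than `(ε/2)/(C+1)`; the `+
  -- 1` avoids division by zero.
  set C : ℝ≥0∞ := ENNReal.ofReal (Real.exp (t + 1) / (t / 4)) * B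
  have hC : C ≠ ∞ := (ENNReal.mul_lt_top ENNReal.ofReal_lt_top hB.lt_top).ne
  obtain ⟨δ, hδ, hδA⟩ := exists_pos_setLIntegral_lt_of_measure_lt (μ := volume) (f := A)
    (by simp [hA.lintegral_eq_one])
    (ENNReal.div_pos (ENNReal.half_pos hε.ne').ne' (ENNReal.add_ne_top.2 ⟨hC, ENNReal.one_ne_top⟩)).ne'
  obtain ⟨η', hη', hη'δ⟩ := ENNReal.lt_iff_exists_nnreal_btwn.1 hδ
  set η : ℝ := min (η' : ℝ) (t / 4)
  have hη : 0 < η := lt_min (by exact_mod_cast hη') (by linarith)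
  have hηt : η ≤ t / 4 := min_le_right _ _
  have hA1 : Measurable ((Ioo 0 η).indicator A) := hA.measurable.indicator measurableSet_Ioo
  have hA2 : Measurable ((Ici η).indicator A) := hA.measurable.indicator measurableSet_Ici
  have hsplit : ∀ s, mconv (volume.withDensity A) (renewalDensity A) s
      = mconv (volume.withDensity ((Ioo 0 η).indicator A)) (renewalDensity A) s
        + mconv (volume.withDensity (renewalDensity A)) ((Ici η).indicator A) s := by
    intro s
    rw [← mconv_withDensity_comm hA2 hR, ← withDensity_add_mconv hA1]
    congr 2
    funext x
    rcases le_or_gt x 0 with hx | hx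
    · simp [indicator_apply, hA.eq_zero x hx]
    · rcases lt_or_ge x η with h | h
      · simp [hx, h]
      · simp [h]
  have hsmall : ∀ s ∈ Ioo (t / 2) (t + 1),
      mconv (volume.withDensity ((Ioo 0 η).indicator A)) (renewalDensity A) s ≤ ε / 2 := by
    intro s hs
    rw [mconv_withDensity hA1 hR]
    calc ∫⁻ x, (Ioo 0 η).indicator A x * renewalDensity A (s - x)
        ≤ ∫⁻ x, (Ioo 0 η).indicator A x * C := by
          refine lintegral_mono fun x => ?_
          by_cases hx : x ∈ Ioo 0 η
          · refine mul_le_mul_right (ENNReal.le_of_mul_exp_neg_mul_le (by linarith) ?_ ?_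
              (hBt _)) _
            · linarith [hx.2, hs.1]
            · linarith [hx.1, hs.2]
          · simp [indicator_of_notMem hx]
      _ = (∫⁻ x in Ioo 0 η, A x) * C := by
          rw [lintegral_mul_const _ hA1, lintegral_indicator measurableSet_Ioo]
      _ ≤ (ε / 2) / (C + 1) * (C + 1) := by
          refine mul_le_mul' (hδA _ ?_).le le_self_add
          rw [Real.volume_Ioo, sub_zero]
          refine lt_of_le_of_lt ?_ hη'δ
          rw [← ENNReal.ofReal_coe_nnreal]
          exact ENNReal.ofReal_le_ofReal (min_le_left _ _)
      _ = ε / 2 := ENNReal.div_mul_cancel (by simp) (by simp [hC])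
  have hcont := hA.continuousAt_mconv_indicator hAc hb hη t
  have hfin2 : mconv (volume.withDensity (renewalDensity A)) ((Ici η).indicator A) t ≠ ∞ := by
    rw [hsplit] at hfin
    exact (ENNReal.add_ne_top.1 hfin).2
  filter_upwards [(ENNReal.tendsto_nhds hfin2).1 hcont _ (ENNReal.half_pos hε.ne'),
    Ioo_mem_nhds (show t / 2 < t by linarith) (lt_add_one t)] with s hs hst
  have h1 := hsmall s hst
  have h2 := hsmall t ⟨by linarith, lt_add_one t⟩
  rw [hsplit s, hsplit t]
  constructor
  · rw [tsub_le_iff_right]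
    calc _ ≤ ε / 2 + (mconv (volume.withDensity (renewalDensity A)) ((Ici η).indicator A) s
            + ε / 2) := add_le_add h2 (tsub_le_iff_right.1 hs.1)
      _ = mconv (volume.withDensity (renewalDensity A)) ((Ici η).indicator A) s + ε := by
          rw [add_left_comm, ENNReal.add_halves]
      _ ≤ _ := by gcongr; exact le_add_self
  · calc _ ≤ ε / 2 + (mconv (volume.withDensity (renewalDensity A)) ((Ici η).indicator A) t
            + ε / 2) := add_le_add h1 hs.2
      _ = mconv (volume.withDensity (renewalDensity A)) ((Ici η).indicator A) t + ε := by
          rw [add_left_comm, ENNReal.add_halves]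
      _ ≤ _ := by gcongr; exact le_add_self

end IsDelayDensity

/-! ### Survival functions and inversion of the convolution -/

/-- The survival function of a measure, extended by `0` to the negative half-line. -/
noncomputable def survival (μ : Measure ℝ) (t : ℝ) : ℝ≥0∞ :=
  (Ici (0 : ℝ)).indicator (fun t => μ (Ioi t)) t

theorem survival_of_nonneg (μ : Measure ℝ) {t : ℝ} (ht : 0 ≤ t) : survival μ t = μ (Ioi t) :=
  indicator_of_mem (mem_Ici.2 ht) _

theorem survival_of_neg (μ : Measure ℝ) {t : ℝ} (ht : t < 0) : survival μ t = 0 :=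
  indicator_of_notMem (by simpa using ht) _

theorem measurable_survival (μ : Measure ℝ) : Measurable (survival μ) :=
  Measurable.indicator (Antitone.measurable fun _ _ h => measure_mono (Ioi_subset_Ioi h))
    measurableSet_Ici

theorem mconv_indicator_one (μ : Measure ℝ) (t : ℝ) :
    mconv μ ((Ici (0 : ℝ)).indicator 1) t = μ (Iic t) := by
  rw [mconv, ← lintegral_indicator_one measurableSet_Iic]
  refine lintegral_congr fun x => ?_
  simp [indicator_apply]

namespace IsDelayDensity

variable {A : ℝ → ℝ≥0∞}

theorem survival_add_mconv (hA : IsDelayDensity A) (t : ℝ) :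
    survival (volume.withDensity A) t
      + mconv (volume.withDensity A) ((Ici (0 : ℝ)).indicator 1) t
      = (Ici (0 : ℝ)).indicator 1 t := by
  rcases lt_or_ge t 0 with ht | ht
  · rw [survival_of_neg _ ht, hA.mconv_eq_zero (measurable_one.indicator measurableSet_Ici)
      (fun s hs => indicator_of_notMem (by simpa using hs) _) ht.le]
    simp [ht]
  · rw [survival_of_nonneg _ ht, mconv_indicator_one,
      ← measure_union (Ioi_disjoint_Iic le_rfl) measurableSet_Iic, Ioi_union_Iic]
    simp [ht, hA.lintegral_eq_one]

theorem mconv_renewalDensity (hA : IsDelayDensity A) {f : ℝ → ℝ≥0∞} (hf : Measurable f) (t : ℝ) :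
    mconv (volume.withDensity (renewalDensity A)) f t
      = mconv (volume.withDensity A) f t + mconv (volume.withDensity (renewalDensity A))
          (mconv (volume.withDensity A) f) t := by
  have hR := hA.measurable_renewalDensity
  have h := funext hA.renewalDensity_eq
  conv_lhs => rw [h]
  rw [withDensity_add_mconv hA.measurable, mconv_withDensity_mconv hR hf, mconv_comm hf]

/-- The renewal measure inverts the convolution with the survival function. -/
theorem survival_add_mconv_renewalDensity (hA : IsDelayDensity A) (t : ℝ) :
    survival (volume.withDensity A) t
      + mconv (volume.withDensity (renewalDensity A)) (survival (volume.withDensity A)) t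
      = (Ici (0 : ℝ)).indicator 1 t := by
  -- Write `1` for the indicator of `[0,∞)` and `S` for the survival function, so `1 = S + A * 1`.
  -- Then `R * 1` equals both `A * 1 + R * (A * 1)` and `R * S + R * (A * 1)`. Cancelling the finite
  -- common term gives `R * S = A * 1`.
  have hI : Measurable ((Ici (0 : ℝ)).indicator (1 : ℝ → ℝ≥0∞)) :=
    measurable_one.indicator measurableSet_Ici
  have h1 := hA.mconv_renewalDensity hI t
  have h2 : mconv (volume.withDensity (renewalDensity A)) ((Ici (0 : ℝ)).indicator 1) t
      = mconv (volume.withDensity (renewalDensity A)) (survival (volume.withDensity A)) t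
        + mconv (volume.withDensity (renewalDensity A))
          (mconv (volume.withDensity A) ((Ici (0 : ℝ)).indicator 1)) t := by
    rw [← mconv_add (measurable_survival _)]
    exact congrFun (congrArg _ (funext fun s => (hA.survival_add_mconv s).symm)) t
  have hfin : mconv (volume.withDensity (renewalDensity A)) ((Ici (0 : ℝ)).indicator 1) t ≠ ∞ := by
    rw [mconv_indicator_one, withDensity_apply _ measurableSet_Iic]
    exact (hA.setLIntegral_renewalDensity_lt_top t).ne
  have h3 : mconv (volume.withDensity (renewalDensity A))
          (mconv (volume.withDensity A) ((Ici (0 : ℝ)).indicator 1)) t ≠ ∞ := by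
    rw [h1] at hfin
    exact (ENNReal.add_ne_top.1 hfin).2
  rw [h2] at h1
  rw [(ENNReal.add_left_inj h3).1 h1, hA.survival_add_mconv]

/-- Convolve `1 = S + R * S` with `ν`: the distribution function of `ν` is recovered from `ν * S`
alone. -/
theorem measure_Iic_eq (hA : IsDelayDensity A) (ν : Measure ℝ) [SFinite ν] (t : ℝ) :
    ν (Iic t) = mconv ν (survival (volume.withDensity A)) t
      + mconv (volume.withDensity (renewalDensity A))
          (mconv ν (survival (volume.withDensity A))) t := by
  rw [mconv_comm (measurable_survival _), ← mconv_add (measurable_survival _),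
    ← mconv_indicator_one]
  exact congrFun (congrArg _ (funext fun s => (hA.survival_add_mconv_renewalDensity s).symm)) t

/-- The convolution of a measure with the survival function determines the measure. -/
theorem measure_Iic_congr (hA : IsDelayDensity A) {ν₁ ν₂ : Measure ℝ} [SFinite ν₁] [SFinite ν₂]
    {t : ℝ} (ht : mconv ν₁ (survival (volume.withDensity A)) t
      = mconv ν₂ (survival (volume.withDensity A)) t)
    (hae : ∀ᵐ s, s < t → mconv ν₁ (survival (volume.withDensity A)) s
      = mconv ν₂ (survival (volume.withDensity A)) s) :
    ν₁ (Iic t) = ν₂ (Iic t) := by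
  have hR := hA.measurable_renewalDensity
  have hm : ∀ (ν : Measure ℝ) [SFinite ν],
      Measurable (mconv ν (survival (volume.withDensity A))) := fun ν _ =>
    measurable_mconv (measurable_survival _)
  -- In the inversion formula `ν * S` occurs once at the point `t` and otherwise under an integral
  -- against `R(t - s)`, which vanishes for `s ≥ t`.
  rw [hA.measure_Iic_eq, hA.measure_Iic_eq, ht, mconv_withDensity_comm hR (hm ν₁),
    mconv_withDensity_comm hR (hm ν₂), mconv_withDensity (hm ν₁) hR,
    mconv_withDensity (hm ν₂) hR]
  congr 1
  refine lintegral_congr_ae ?_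
  filter_upwards [hae] with s hs
  rcases lt_or_ge s t with h | h
  · rw [hs h]
  · rw [hA.renewalDensity_eq_zero (by linarith), mul_zero, mul_zero]

end IsDelayDensity

/-! ### The delay law attached to a weighting function -/

/-- The density of the delay whose survival function is `u ↦ w(e^{-u})`. -/
noncomputable def weightDensity (w : ℝ → ℝ) : ℝ → ℝ≥0∞ :=
  (Ioi (0 : ℝ)).indicator fun t => ENNReal.ofReal (Real.exp (-t) * deriv w (Real.exp (-t)))

theorem Real.exp_neg_mem_Ioo {t : ℝ} (ht : 0 < t) : Real.exp (-t) ∈ Ioo (0 : ℝ) 1 :=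
  ⟨Real.exp_pos _, Real.exp_lt_one_iff.2 (by linarith)⟩

theorem Real.exp_neg_mem_Ioc {t : ℝ} (ht : 0 ≤ t) : Real.exp (-t) ∈ Ioc (0 : ℝ) 1 :=
  ⟨Real.exp_pos _, Real.exp_le_one_iff.2 (by linarith)⟩

namespace IsWeighting

variable {w : ℝ → ℝ}

theorem continuousOn_comp_exp (hw : IsWeighting w) :
    ContinuousOn (fun u => w (Real.exp (-u))) (Ici 0) :=
  hw.continuousOn.comp (by fun_prop) fun _ hu => Ioc_subset_Icc_self (Real.exp_neg_mem_Ioc hu)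

theorem continuousOn_comp_exp_add (hw : IsWeighting w) (t : ℝ) :
    ContinuousOn (fun s => w (Real.exp (-t + s))) (Iic t) :=
  hw.continuousOn.comp (by fun_prop) fun s hs =>
    ⟨(Real.exp_pos _).le, Real.exp_le_one_iff.2 (by linarith [mem_Iic.1 hs])⟩

theorem hasDerivAt_neg_comp_exp (hw : IsWeighting w) {t : ℝ} (ht : 0 < t) :
    HasDerivAt (fun u => -w (Real.exp (-u))) (Real.exp (-t) * deriv w (Real.exp (-t))) t := by
  have h1 : HasDerivAt (fun u : ℝ => Real.exp (-u)) (Real.exp (-t) * -1) t :=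
    (hasDerivAt_neg t).exp
  exact ((hw.hasDerivAt (Real.exp_neg_mem_Ioo ht)).comp t h1).neg.congr_deriv (by ring)

theorem exp_mul_deriv_nonneg (hw : IsWeighting w) {t : ℝ} (ht : 0 < t) :
    0 ≤ Real.exp (-t) * deriv w (Real.exp (-t)) :=
  mul_nonneg (Real.exp_pos _).le (hw.deriv_nonneg (Real.exp_neg_mem_Ioo ht))

theorem tendsto_comp_exp (hw : IsWeighting w) :
    Tendsto (fun u => -w (Real.exp (-u))) atTop (𝓝 0) := by
  have h1 := hw.continuousOn 0 (left_mem_Icc.2 zero_le_one)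
  have h2 : Tendsto (fun u : ℝ => Real.exp (-u)) atTop (𝓝[Icc 0 1] 0) := by
    refine tendsto_nhdsWithin_iff.2 ⟨Real.tendsto_exp_neg_atTop_nhds_zero, ?_⟩
    filter_upwards [eventually_ge_atTop 0] with u hu
    exact Ioc_subset_Icc_self (Real.exp_neg_mem_Ioc hu)
  have := (h1.tendsto.comp h2).neg
  rwa [hw.map_zero, neg_zero] at this

theorem continuousOn_exp_mul_deriv (hw : IsWeighting w) :
    ContinuousOn (fun t => Real.exp (-t) * deriv w (Real.exp (-t))) (Ioi 0) :=
  ContinuousOn.mul (by fun_prop)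
    (hw.continuousOn_deriv.comp (by fun_prop) fun _ ht => Real.exp_neg_mem_Ioo ht)

theorem _root_.measurable_weightDensity (w : ℝ → ℝ) : Measurable (weightDensity w) := by
  have : Measurable (fun t => ENNReal.ofReal (Real.exp (-t) * deriv w (Real.exp (-t)))) :=
    ((by fun_prop : Measurable fun t : ℝ => Real.exp (-t)).mul
      ((measurable_deriv w).comp (by fun_prop))).ennreal_ofReal
  exact this.indicator measurableSet_Ioi

/-- `-w(e^{-u})` is a monotone antiderivative of the density. Continuity suffices at the end point
`c`, so an infinite slope `w'(1)` does no harm at `c = 0`. -/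
theorem withDensity_Ioi (hw : IsWeighting w) {c : ℝ} (hc : 0 ≤ c) :
    volume.withDensity (weightDensity w) (Ioi c) = ENNReal.ofReal (w (Real.exp (-c))) := by
  have hcont : ContinuousWithinAt (fun u => -w (Real.exp (-u))) (Ici c) c :=
    (hw.continuousOn_comp_exp.neg c hc).mono (Ici_subset_Ici.2 hc)
  have hd : ∀ x ∈ Ioi c, HasDerivAt (fun u => -w (Real.exp (-u)))
      (Real.exp (-x) * deriv w (Real.exp (-x))) x := fun x hx =>
    hw.hasDerivAt_neg_comp_exp (hc.trans_lt hx)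
  have hn : ∀ x ∈ Ioi c, 0 ≤ Real.exp (-x) * deriv w (Real.exp (-x)) := fun x hx =>
    hw.exp_mul_deriv_nonneg (hc.trans_lt hx)
  have h1 := integral_Ioi_of_hasDerivAt_of_nonneg hcont hd hn hw.tendsto_comp_exp
  have h2 := integrableOn_Ioi_deriv_of_nonneg hcont hd hn hw.tendsto_comp_exp
  rw [zero_sub, neg_neg] at h1
  rw [withDensity_apply _ measurableSet_Ioi, ← h1, ofReal_integral_eq_lintegral_ofReal h2
    (ae_restrict_of_forall_mem measurableSet_Ioi hn)]
  exact setLIntegral_congr_fun measurableSet_Ioi fun x hx =>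
    indicator_of_mem (mem_Ioi.2 (hc.trans_lt hx)) _

theorem isDelayDensity (hw : IsWeighting w) : IsDelayDensity (weightDensity w) where
  measurable := measurable_weightDensity w
  eq_zero t ht := indicator_of_notMem (by simpa using ht) _
  lintegral_eq_one := by
    have h := hw.withDensity_Ioi le_rfl
    rw [neg_zero, Real.exp_zero, hw.map_one, ENNReal.ofReal_one,
      withDensity_apply _ measurableSet_Ioi, ← lintegral_indicator measurableSet_Ioi] at h
    rw [← h, weightDensity, indicator_indicator, inter_self]

theorem continuousOn_weightDensity (hw : IsWeighting w) :
    ContinuousOn (weightDensity w) (Ioi 0) :=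
  (ENNReal.continuous_ofReal.comp_continuousOn hw.continuousOn_exp_mul_deriv).congr
    fun _ ht => indicator_of_mem ht _

/-- For `t > 0` and `p = e^{-t}` the product is `t p · p w'(p)`, and `t p ≤ 1 - p` because `1 + t ≤
e^t`. Each alternative of `mul_deriv_le` then gives the bound. -/
theorem mul_exp_neg_mul_weightDensity_le (hw : IsWeighting w) (t : ℝ) :
    ENNReal.ofReal t * (ENNReal.ofReal (Real.exp (-t)) * weightDensity w t) ≤ 1 := by
  rcases le_or_gt t 0 with ht | ht
  · simp [ENNReal.ofReal_of_nonpos ht]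
  have hp := Real.exp_neg_mem_Ioo ht
  set p := Real.exp (-t) with hpdef
  have hd := hw.deriv_nonneg hp
  have htp : t * p ≤ 1 - p := by
    have h1 := Real.add_one_le_exp t
    have h2 : Real.exp t * p = 1 := by rw [hpdef, ← Real.exp_add]; simp
    nlinarith [hp.1]
  rw [weightDensity, indicator_of_mem (mem_Ioi.2 ht), ← hpdef, ← ENNReal.ofReal_mul hp.1.le,
    ← ENNReal.ofReal_mul ht.le, ENNReal.ofReal_le_one, ← mul_assoc]
  rcases hw.mul_deriv_le hp with h | h
  · exact mul_le_one₀ (htp.trans (by linarith [hp.1])) (mul_nonneg hp.1.le hd) h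
  · calc t * p * (p * deriv w p) ≤ (1 - p) * (p * deriv w p) :=
          mul_le_mul_of_nonneg_right htp (mul_nonneg hp.1.le hd)
      _ = p * ((1 - p) * deriv w p) := by ring
      _ ≤ 1 := mul_le_one₀ hp.2.le (mul_nonneg (sub_nonneg.2 hp.2.le) hd) h

theorem survival_eq (hw : IsWeighting w) {u : ℝ} (hu : 0 ≤ u) :
    survival (volume.withDensity (weightDensity w)) u = ENNReal.ofReal (w (Real.exp (-u))) := by
  rw [survival_of_nonneg _ hu, hw.withDensity_Ioi hu]

theorem intervalIntegrable_kernel_mul (hw : IsWeighting w) {g : ℝ → ℝ} {a b t : ℝ}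
    (ha : a ≤ t) (hb : b ≤ t) (hg : IntervalIntegrable g volume a b) :
    IntervalIntegrable (fun s => w (Real.exp (-t + s)) * g s) volume a b :=
  hg.continuousOn_mul ((hw.continuousOn_comp_exp_add t).mono fun _ hs =>
    (mem_uIcc.1 hs).elim (fun h => h.2.trans hb) fun h => h.2.trans ha)

theorem kernel_nonneg (hw : IsWeighting w) {s t : ℝ} (h : s ≤ t) : 0 ≤ w (Real.exp (-t + s)) :=
  (hw.mapsTo ⟨(Real.exp_pos _).le, Real.exp_le_one_iff.2 (by linarith)⟩).1

theorem kernel_le_one (hw : IsWeighting w) {s t : ℝ} (h : s ≤ t) : w (Real.exp (-t + s)) ≤ 1 :=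
  (hw.mapsTo ⟨(Real.exp_pos _).le, Real.exp_le_one_iff.2 (by linarith)⟩).2

theorem mconv_survival_eq_ofReal (hw : IsWeighting w) {g : ℝ → ℝ} {G : ℝ → ℝ≥0∞} {t : ℝ}
    (hG : Measurable G) (h0 : ∀ s < 0, G s = 0) (ht : 0 ≤ t)
    (hGg : ∀ s ∈ Ioc 0 t, G s = ENNReal.ofReal (g s)) (hg0 : ∀ s ∈ Ioc 0 t, 0 ≤ g s)
    (hg : IntervalIntegrable g volume 0 t) :
    mconv (volume.withDensity G) (survival (volume.withDensity (weightDensity w))) t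
      = ENNReal.ofReal (∫ s in 0..t, w (Real.exp (-t + s)) * g s) := by
  rw [mconv_withDensity hG (measurable_survival _), intervalIntegral.integral_of_le ht,
    ofReal_integral_eq_lintegral_ofReal (hw.intervalIntegrable_kernel_mul ht le_rfl hg).1
      (ae_restrict_of_forall_mem measurableSet_Ioc fun s hs =>
        mul_nonneg (hw.kernel_nonneg hs.2) (hg0 s hs)), ← lintegral_indicator measurableSet_Ioc]
  have hne : ∀ᵐ s : ℝ, s ≠ 0 := by simp [ae_iff]
  refine lintegral_congr_ae ?_
  filter_upwards [hne] with s hs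
  rcases lt_or_gt_of_ne hs with h | h
  · rw [h0 s h, zero_mul, indicator_of_notMem (by simp [h.le])]
  · rcases le_or_gt s t with hst | hst
    · rw [indicator_of_mem (mem_Ioc.2 ⟨h, hst⟩), hGg s ⟨h, hst⟩,
        hw.survival_eq (sub_nonneg.2 hst), ENNReal.ofReal_mul (hw.kernel_nonneg hst), mul_comm]
      congr 4
      ring
    · rw [survival_of_neg _ (by linarith), mul_zero, indicator_of_notMem (by simp [hst])]

/-- Convolution with `u ↦ w(e^{-u})` is injective on integrable functions. -/
theorem ae_eq_zero_of_kernel_integral_eq_zero (hw : IsWeighting w) {h : ℝ → ℝ} {T : ℝ}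
    (hh : IntegrableOn h (Icc 0 T))
    (hz : ∀ t ∈ Icc 0 T, ∫ s in 0..t, w (Real.exp (-t + s)) * h s = 0) :
    h =ᵐ[volume.restrict (Icc 0 T)] 0 := by
  have hA := hw.isDelayDensity
  obtain ⟨h', hm, hh'⟩ := hh.aestronglyMeasurable
  have hm' := hm.measurable
  refine hh'.trans ?_
  have hi' : IntegrableOn h' (Icc 0 T) := hh.congr hh'
  have hii : ∀ t ∈ Icc 0 T, IntervalIntegrable h' volume 0 t := fun t ht =>
    (intervalIntegrable_iff_integrableOn_Icc_of_le ht.1).2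
      (hi'.mono_set (Icc_subset_Icc_right ht.2))
  have hz' : ∀ t ∈ Icc 0 T, ∫ s in 0..t, w (Real.exp (-t + s)) * h' s = 0 := by
    intro t ht
    refine Eq.trans (intervalIntegral.integral_congr_ae_restrict ?_) (hz t ht)
    rw [uIoc_of_le ht.1]
    filter_upwards [ae_restrict_of_ae_restrict_of_subset
      (Ioc_subset_Icc_self.trans (Icc_subset_Icc_right ht.2)) hh'] with s hs
    rw [hs]
  -- The positive and negative parts of `h'` on `[0,T]` are densities of two finite measures with
  -- the same convolution with the kernel up to time `T`. By inversion the measures coincide, so the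
  -- two parts agree almost everywhere and both vanish.
  set G₁ : ℝ → ℝ≥0∞ := (Icc 0 T).indicator fun s => ENNReal.ofReal (h' s) with hG₁
  set G₂ : ℝ → ℝ≥0∞ := (Icc 0 T).indicator fun s => ENNReal.ofReal (-h' s) with hG₂
  have hmG₁ : Measurable G₁ := hm'.ennreal_ofReal.indicator measurableSet_Icc
  have hmG₂ : Measurable G₂ := hm'.neg.ennreal_ofReal.indicator measurableSet_Icc
  have hconv : ∀ t ≤ T, mconv (volume.withDensity G₁)
        (survival (volume.withDensity (weightDensity w))) t
      = mconv (volume.withDensity G₂) (survival (volume.withDensity (weightDensity w))) t := by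
    intro t htT
    rcases lt_or_ge t 0 with ht | ht
    · have : ∀ G : ℝ → ℝ≥0∞, Measurable G → (∀ s < 0, G s = 0) → mconv (volume.withDensity G)
          (survival (volume.withDensity (weightDensity w))) t = 0 := by
        intro G hG h0
        rw [mconv_withDensity hG (measurable_survival _)]
        refine (lintegral_congr fun s => ?_).trans lintegral_zero
        rcases lt_or_ge s 0 with hs | hs
        · rw [h0 s hs, zero_mul]
        · rw [survival_of_neg _ (by linarith), mul_zero]
      rw [this G₁ hmG₁ fun s hs => indicator_of_notMem (by simp [hs]) _,
        this G₂ hmG₂ fun s hs => indicator_of_notMem (by simp [hs]) _]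
    · have hmem : ∀ s ∈ Ioc 0 t, s ∈ Icc 0 T := fun s hs => ⟨hs.1.le, hs.2.trans htT⟩
      have i1 : IntervalIntegrable (fun s => max (h' s) 0) volume 0 t :=
        ⟨(hii t ⟨ht, htT⟩).1.pos_part, (hii t ⟨ht, htT⟩).2.pos_part⟩
      have i2 : IntervalIntegrable (fun s => max (-h' s) 0) volume 0 t :=
        ⟨(hii t ⟨ht, htT⟩).1.neg_part, (hii t ⟨ht, htT⟩).2.neg_part⟩
      rw [hw.mconv_survival_eq_ofReal (g := fun s => max (h' s) 0) hmG₁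
          (fun s hs => indicator_of_notMem (by simp [hs]) _) ht ?_ (fun _ _ => le_max_right _ _) i1,
        hw.mconv_survival_eq_ofReal (g := fun s => max (-h' s) 0) hmG₂
          (fun s hs => indicator_of_notMem (by simp [hs]) _) ht ?_ (fun _ _ => le_max_right _ _) i2]
      · congr 1
        rw [← sub_eq_zero, ← intervalIntegral.integral_sub
          (hw.intervalIntegrable_kernel_mul ht le_rfl i1)
          (hw.intervalIntegrable_kernel_mul ht le_rfl i2)]
        refine Eq.trans ?_ (hz' t ⟨ht, htT⟩)
        refine intervalIntegral.integral_congr fun s _ => ?_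
        rw [← mul_sub, max_zero_sub_max_neg_zero_eq_self]
      · intro s hs
        rw [hG₂, indicator_of_mem (hmem s hs), ENNReal.ofReal_max]
        simp
      · intro s hs
        rw [hG₁, indicator_of_mem (hmem s hs), ENNReal.ofReal_max]
        simp
  have hfin₁ : ∫⁻ s, G₁ s ≠ ∞ := by
    rw [hG₁, lintegral_indicator measurableSet_Icc]
    exact hi'.lintegral_lt_top.ne
  have hfin₂ : ∫⁻ s, G₂ s ≠ ∞ := by
    rw [hG₂, lintegral_indicator measurableSet_Icc]
    exact hi'.neg.lintegral_lt_top.ne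
  have hIic : ∀ t ≤ T, volume.withDensity G₁ (Iic t) = volume.withDensity G₂ (Iic t) :=
    fun t ht => hA.measure_Iic_congr (hconv t ht) (ae_of_all _ fun s hs => hconv s (hs.le.trans ht))
  have hbig : ∀ G : ℝ → ℝ≥0∞, (∀ s, T < s → G s = 0) → ∀ t, T ≤ t →
      volume.withDensity G (Iic t) = volume.withDensity G (Iic T) := by
    intro G hG t ht
    rw [withDensity_apply _ measurableSet_Iic, withDensity_apply _ measurableSet_Iic,
      ← lintegral_indicator measurableSet_Iic, ← lintegral_indicator measurableSet_Iic]
    refine lintegral_congr fun s => ?_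
    rcases le_or_gt s T with hs | hs
    · rw [indicator_of_mem (mem_Iic.2 hs), indicator_of_mem (mem_Iic.2 (hs.trans ht))]
    · simp [indicator_apply, hG s hs]
  have hmeas : volume.withDensity G₁ = volume.withDensity G₂ := by
    have : IsFiniteMeasure (volume.withDensity G₁) := isFiniteMeasure_withDensity hfin₁
    refine Measure.ext_of_Iic _ _ fun t => ?_
    rcases le_total t T with ht | ht
    · exact hIic t ht
    · rw [hbig G₁ (fun s hs => indicator_of_notMem (by simp [hs]) _) t ht,
        hbig G₂ (fun s hs => indicator_of_notMem (by simp [hs]) _) t ht, hIic T le_rfl]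
  have hGG := (withDensity_eq_iff hmG₁.aemeasurable hmG₂.aemeasurable hfin₁).1 hmeas
  filter_upwards [ae_restrict_of_ae hGG, ae_restrict_mem measurableSet_Icc] with s hs hsT
  rw [hG₁, hG₂, indicator_of_mem hsT, indicator_of_mem hsT] at hs
  change h' s = 0
  rcases le_total 0 (h' s) with h0 | h0
  · rw [ENNReal.ofReal_of_nonpos (neg_nonpos.2 h0), ENNReal.ofReal_eq_zero] at hs
    exact le_antisymm hs h0
  · rw [ENNReal.ofReal_of_nonpos h0, eq_comm, ENNReal.ofReal_eq_zero] at hs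
    linarith

end IsWeighting

/-! ### Explicit solutions of the integral equations -/

/-- The renewal density of the delay with survival function `u ↦ w(e^{-u})`, as a real function. -/
noncomputable def renewalRate (w : ℝ → ℝ) (t : ℝ) : ℝ :=
  (renewalDensity (weightDensity w) t).toReal

/-- The solution `v = e + e * r` of the renewal equation with exponential input. -/
noncomputable def expRenewal (w : ℝ → ℝ) (t : ℝ) : ℝ :=
  Real.exp (-t) * (1 + ∫ s in 0..t, Real.exp s * renewalRate w s)

/-- The density of the multiplier of the rationality constraints. -/
noncomputable def multiplier (w : ℝ → ℝ) (t : ℝ) : ℝ := renewalRate w t - expRenewal w t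

theorem renewalRate_nonneg (w : ℝ → ℝ) (t : ℝ) : 0 ≤ renewalRate w t := ENNReal.toReal_nonneg

namespace IsWeighting

variable {w : ℝ → ℝ}

theorem renewalDensity_ne_top (hw : IsWeighting w) (t : ℝ) :
    renewalDensity (weightDensity w) t ≠ ∞ :=
  hw.isDelayDensity.renewalDensity_ne_top hw.mul_exp_neg_mul_weightDensity_le t

theorem ofReal_renewalRate (hw : IsWeighting w) (t : ℝ) :
    ENNReal.ofReal (renewalRate w t) = renewalDensity (weightDensity w) t :=
  ENNReal.ofReal_toReal (hw.renewalDensity_ne_top t)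

theorem measurable_renewalRate (hw : IsWeighting w) : Measurable (renewalRate w) :=
  hw.isDelayDensity.measurable_renewalDensity.ennreal_toReal

theorem continuousOn_renewalRate (hw : IsWeighting w) : ContinuousOn (renewalRate w) (Ioi 0) :=
  ENNReal.continuousOn_toReal.comp (hw.isDelayDensity.continuousOn_renewalDensity
    hw.continuousOn_weightDensity hw.mul_exp_neg_mul_weightDensity_le)
    fun t _ => hw.renewalDensity_ne_top t

theorem integrableOn_renewalRate (hw : IsWeighting w) (T : ℝ) :
    IntegrableOn (renewalRate w) (Iic T) :=
  integrable_toReal_of_lintegral_ne_top hw.isDelayDensity.measurable_renewalDensity.aemeasurable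
    (hw.isDelayDensity.setLIntegral_renewalDensity_lt_top T).ne

theorem intervalIntegrable_renewalRate (hw : IsWeighting w) (a b : ℝ) :
    IntervalIntegrable (renewalRate w) volume a b :=
  ⟨(hw.integrableOn_renewalRate b).mono_set Ioc_subset_Iic_self,
    (hw.integrableOn_renewalRate a).mono_set Ioc_subset_Iic_self⟩

theorem intervalIntegrable_exp_mul_renewalRate (hw : IsWeighting w) (a b : ℝ) :
    IntervalIntegrable (fun s => Real.exp s * renewalRate w s) volume a b :=
  (hw.intervalIntegrable_renewalRate a b).continuousOn_mul Real.continuous_exp.continuousOn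

theorem renewalRate_eq (hw : IsWeighting w) {t : ℝ} (ht : 0 < t) :
    renewalRate w t = Real.exp (-t) * deriv w (Real.exp (-t)) +
      (mconv (volume.withDensity (weightDensity w))
        (renewalDensity (weightDensity w)) t).toReal := by
  have h := hw.isDelayDensity.renewalDensity_eq t
  have hne := hw.renewalDensity_ne_top t
  rw [h] at hne
  rw [renewalRate, h, ENNReal.toReal_add (ENNReal.add_ne_top.1 hne).1 (ENNReal.add_ne_top.1 hne).2,
    weightDensity, indicator_of_mem (mem_Ioi.2 ht),
    ENNReal.toReal_ofReal (hw.exp_mul_deriv_nonneg ht)]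

/-- The renewal rate solves the binding equation, with time reversed. -/
theorem kernel_add_integral_renewalRate (hw : IsWeighting w) {t : ℝ} (ht : 0 ≤ t) :
    w (Real.exp (-t)) + ∫ s in 0..t, w (Real.exp (-t + s)) * renewalRate w s = 1 := by
  have hA := hw.isDelayDensity
  have h := hA.survival_add_mconv_renewalDensity t
  have hk : 0 ≤ w (Real.exp (-t)) := by simpa using hw.kernel_nonneg ht
  have hI : 0 ≤ ∫ s in 0..t, w (Real.exp (-t + s)) * renewalRate w s :=
    intervalIntegral.integral_nonneg ht fun s hs =>
      mul_nonneg (hw.kernel_nonneg hs.2) (renewalRate_nonneg w s)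
  rw [hw.survival_eq ht, hw.mconv_survival_eq_ofReal (g := renewalRate w)
    hA.measurable_renewalDensity (fun s hs => hA.renewalDensity_eq_zero hs.le) ht
    (fun s _ => (hw.ofReal_renewalRate s).symm) (fun s _ => renewalRate_nonneg w s)
    (hw.intervalIntegrable_renewalRate 0 t), ← ENNReal.ofReal_add hk hI,
    indicator_of_mem (mem_Ici.2 ht), Pi.one_apply, ENNReal.ofReal_eq_one] at h
  exact h

theorem expRenewal_nonneg (w : ℝ → ℝ) {t : ℝ} (ht : 0 ≤ t) : 0 ≤ expRenewal w t :=
  mul_nonneg (Real.exp_pos _).le (add_nonneg zero_le_one (intervalIntegral.integral_nonneg ht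
    fun s _ => mul_nonneg (Real.exp_pos _).le (renewalRate_nonneg w s)))

theorem continuous_expRenewal (hw : IsWeighting w) : Continuous (expRenewal w) :=
  (by fun_prop : Continuous fun t : ℝ => Real.exp (-t)).mul (continuous_const.add
    (intervalIntegral.continuous_primitive (fun a b =>
      hw.intervalIntegrable_exp_mul_renewalRate a b) 0))

theorem ofReal_expRenewal (hw : IsWeighting w) {t : ℝ} (ht : 0 ≤ t) :
    ENNReal.ofReal (expRenewal w t)
      = (Ici (0 : ℝ)).indicator (fun t => ENNReal.ofReal (Real.exp (-t))) t
        + mconv (volume.withDensity (renewalDensity (weightDensity w)))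
          ((Ici (0 : ℝ)).indicator fun t => ENNReal.ofReal (Real.exp (-t))) t := by
  have hA := hw.isDelayDensity
  have hE : Measurable ((Ici (0 : ℝ)).indicator fun t => ENNReal.ofReal (Real.exp (-t))) :=
    (by fun_prop : Measurable fun t : ℝ => ENNReal.ofReal (Real.exp (-t))).indicator
      measurableSet_Ici
  have h1 : mconv (volume.withDensity (renewalDensity (weightDensity w)))
      ((Ici (0 : ℝ)).indicator fun t => ENNReal.ofReal (Real.exp (-t))) t
      = ENNReal.ofReal (∫ s in 0..t, Real.exp (-t) * (Real.exp s * renewalRate w s)) := by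
    rw [mconv_withDensity hA.measurable_renewalDensity hE, intervalIntegral.integral_of_le ht,
      ofReal_integral_eq_lintegral_ofReal
        ((hw.intervalIntegrable_exp_mul_renewalRate 0 t).const_mul _).1
        (ae_of_all _ fun s => mul_nonneg (Real.exp_pos _).le
          (mul_nonneg (Real.exp_pos _).le (renewalRate_nonneg w s))),
      ← lintegral_indicator measurableSet_Ioc]
    refine lintegral_congr fun s => ?_
    rcases le_or_gt s 0 with h | h
    · rw [hA.renewalDensity_eq_zero h, zero_mul, indicator_of_notMem (by simp [h])]
    · rcases le_or_gt s t with hst | hst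
      · rw [indicator_of_mem (mem_Ici.2 (sub_nonneg.2 hst)), indicator_of_mem (mem_Ioc.2 ⟨h, hst⟩),
          ← hw.ofReal_renewalRate, ← ENNReal.ofReal_mul (renewalRate_nonneg w s), ← mul_assoc,
          ← Real.exp_add, mul_comm]
        congr 3
        ring
      · rw [indicator_of_notMem (by simp [hst]), indicator_of_notMem (by simp [hst]), mul_zero]
  rw [h1, indicator_of_mem (mem_Ici.2 ht), intervalIntegral.integral_const_mul,
    ← ENNReal.ofReal_add (Real.exp_pos _).le, expRenewal]
  · congr 1
    ring
  · exact mul_nonneg (Real.exp_pos _).le (intervalIntegral.integral_nonneg ht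
      fun s _ => mul_nonneg (Real.exp_pos _).le (renewalRate_nonneg w s))

/-- With `e(t) = e^{-t}` on `[0,∞)`: `K * (e + R * e) = (K + R * K) * e = 1 * e`, which at `t` is
`∫_0^t e^{-s} ds`. -/
theorem integral_kernel_mul_expRenewal (hw : IsWeighting w) {t : ℝ} (ht : 0 ≤ t) :
    ∫ s in 0..t, w (Real.exp (-t + s)) * expRenewal w s = 1 - Real.exp (-t) := by
  have hA := hw.isDelayDensity
  have hR := hA.measurable_renewalDensity
  set E : ℝ → ℝ≥0∞ := (Ici (0 : ℝ)).indicator fun t => ENNReal.ofReal (Real.exp (-t)) with hEdef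
  have hE : Measurable E :=
    (by fun_prop : Measurable fun t : ℝ => ENNReal.ofReal (Real.exp (-t))).indicator
      measurableSet_Ici
  have hS := measurable_survival (volume.withDensity (weightDensity w))
  have hV := measurable_mconv (μ := volume.withDensity (renewalDensity (weightDensity w))) hE
  have h1 := hw.mconv_survival_eq_ofReal (g := expRenewal w) (t := t) (hE.fun_add hV)
    (fun s hs => ?_) ht (fun s hs => (hw.ofReal_expRenewal hs.1.le).symm)
    (fun s hs => expRenewal_nonneg w hs.1.le) (hw.continuous_expRenewal.intervalIntegrable 0 t)
  · have h2 : volume.withDensity E (Iic t) = ENNReal.ofReal (1 - Real.exp (-t)) := by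
      have h3 : ∫ s in 0..t, Real.exp (-s) = 1 - Real.exp (-t) := by simp
      rw [withDensity_apply _ measurableSet_Iic, ← h3, intervalIntegral.integral_of_le ht,
        ofReal_integral_eq_lintegral_ofReal
          ((by fun_prop : Continuous fun s : ℝ => Real.exp (-s)).intervalIntegrable 0 t).1
          (ae_of_all _ fun s => (Real.exp_pos _).le), hEdef,
        lintegral_indicator measurableSet_Ici, Measure.restrict_restrict measurableSet_Ici,
        Ici_inter_Iic, ← restrict_Ioc_eq_restrict_Icc]
    have h4 : mconv (volume.withDensity fun s => E s +
          mconv (volume.withDensity (renewalDensity (weightDensity w))) E s)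
        (survival (volume.withDensity (weightDensity w))) t = volume.withDensity E (Iic t) := by
      rw [withDensity_add_mconv hE, mconv_withDensity_mconv hE hS, mconv_comm hS,
        ← mconv_add hS, ← mconv_indicator_one]
      exact congrFun (congrArg _ (funext fun s => hA.survival_add_mconv_renewalDensity s)) t
    rw [h4, h2] at h1
    refine ((ENNReal.ofReal_eq_ofReal_iff ?_ ?_).1 h1).symm
    · linarith [(Real.exp_neg_mem_Ioc ht).2]
    · exact intervalIntegral.integral_nonneg ht fun s hs =>
        mul_nonneg (hw.kernel_nonneg hs.2) (expRenewal_nonneg w hs.1)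
  · have h0 : E s = 0 := indicator_of_notMem (by simp [hs]) _
    rw [h0, zero_add, mconv_withDensity hR hE]
    refine (lintegral_congr fun x => ?_).trans lintegral_zero
    rcases le_or_gt x 0 with hx | hx
    · rw [hA.renewalDensity_eq_zero hx, zero_mul]
    · rw [hEdef, indicator_of_notMem (by simp; linarith), mul_zero]

theorem continuousOn_multiplier (hw : IsWeighting w) : ContinuousOn (multiplier w) (Ioi 0) :=
  hw.continuousOn_renewalRate.sub hw.continuous_expRenewal.continuousOn

theorem intervalIntegrable_multiplier (hw : IsWeighting w) (a b : ℝ) :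
    IntervalIntegrable (multiplier w) volume a b :=
  (hw.intervalIntegrable_renewalRate a b).sub (hw.continuous_expRenewal.intervalIntegrable a b)

theorem integral_kernel_mul_multiplier (hw : IsWeighting w) {t : ℝ} (ht : 0 ≤ t) :
    ∫ s in 0..t, w (Real.exp (-t + s)) * multiplier w s
      = Real.exp (-t) - w (Real.exp (-t)) := by
  have h1 := hw.kernel_add_integral_renewalRate ht
  have h2 := hw.integral_kernel_mul_expRenewal ht
  simp only [multiplier, mul_sub]
  rw [intervalIntegral.integral_sub
    (hw.intervalIntegrable_kernel_mul ht le_rfl (hw.intervalIntegrable_renewalRate 0 t))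
    (hw.intervalIntegrable_kernel_mul ht le_rfl
      (hw.continuous_expRenewal.intervalIntegrable 0 t)), h2]
  linarith

theorem tendsto_expRenewal (hw : IsWeighting w) : Tendsto (expRenewal w) (𝓝[>] 0) (𝓝 1) := by
  have h := hw.continuous_expRenewal.tendsto 0
  have h0 : expRenewal w 0 = 1 := by simp [expRenewal]
  rw [h0] at h
  exact h.mono_left nhdsWithin_le_nhds

theorem tendsto_exp_neg : Tendsto (fun t : ℝ => Real.exp (-t)) (𝓝[>] 0) (𝓝[<] 1) := by
  refine tendsto_nhdsWithin_iff.2 ⟨?_, ?_⟩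
  · have := (by fun_prop : Continuous fun t : ℝ => Real.exp (-t)).tendsto 0
    rw [neg_zero, Real.exp_zero] at this
    exact this.mono_left nhdsWithin_le_nhds
  · filter_upwards [self_mem_nhdsWithin] with t ht
    exact (Real.exp_neg_mem_Ioo ht).2

/-- With a finite slope at `1`, the density `A` is at most `d + 1` near `0`, so `(A * R)(t) ≤ (d +
1) ∫_0^t R`, which tends to `0`. -/
theorem tendsto_mconv_renewalDensity (hw : IsWeighting w) {d : ℝ}
    (hd : Tendsto (fun t => Real.exp (-t) * deriv w (Real.exp (-t))) (𝓝[>] 0) (𝓝 d)) :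
    Tendsto (fun t => (mconv (volume.withDensity (weightDensity w))
      (renewalDensity (weightDensity w)) t).toReal) (𝓝[>] 0) (𝓝 0) := by
  have hA := hw.isDelayDensity
  obtain ⟨δ, hδ, hδ'⟩ := mem_nhdsGT_iff_exists_Ioo_subset.1 (hd.eventually_lt_const (lt_add_one d))
  have hlim : Tendsto (fun t => (d + 1) * ∫ s in 0..t, renewalRate w s) (𝓝[>] 0) (𝓝 0) := by
    have := (continuous_const.mul (intervalIntegral.continuous_primitive (fun a b =>
      hw.intervalIntegrable_renewalRate a b) 0)).tendsto (0 : ℝ) (f := fun t =>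
        (d + 1) * ∫ s in 0..t, renewalRate w s)
    simp only [intervalIntegral.integral_same, mul_zero] at this
    exact this.mono_left nhdsWithin_le_nhds
  refine squeeze_zero' (Eventually.of_forall fun _ => ENNReal.toReal_nonneg) ?_ hlim
  filter_upwards [Ioo_mem_nhdsGT hδ] with t ht
  have hd0 : 0 ≤ d + 1 := (hw.exp_mul_deriv_nonneg ht.1).trans (hδ' ht).le
  have hI : 0 ≤ ∫ s in 0..t, renewalRate w s :=
    intervalIntegral.integral_nonneg ht.1.le fun s _ => renewalRate_nonneg w s
  refine ENNReal.toReal_le_of_le_ofReal (mul_nonneg hd0 hI) ?_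
  rw [mconv_withDensity_comm hA.measurable hA.measurable_renewalDensity,
    mconv_withDensity hA.measurable_renewalDensity hA.measurable, ← intervalIntegral.integral_const_mul,
    intervalIntegral.integral_of_le ht.1.le, ofReal_integral_eq_lintegral_ofReal
      ((hw.intervalIntegrable_renewalRate 0 t).const_mul _).1
      (ae_of_all _ fun s => mul_nonneg hd0 (renewalRate_nonneg w s)),
    ← lintegral_indicator measurableSet_Ioc]
  refine lintegral_mono fun s => ?_
  rcases le_or_gt s 0 with h | h
  · rw [hA.renewalDensity_eq_zero h, zero_mul]
    exact zero_le
  · rcases lt_or_ge s t with hst | hst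
    · rw [indicator_of_mem (mem_Ioc.2 ⟨h, hst.le⟩), ENNReal.ofReal_mul hd0, mul_comm,
        hw.ofReal_renewalRate]
      gcongr
      rw [weightDensity, indicator_of_mem (mem_Ioi.2 (sub_pos.2 hst))]
      exact ENNReal.ofReal_le_ofReal (hδ' ⟨sub_pos.2 hst, by linarith [ht.2]⟩).le
    · rw [hA.eq_zero _ (by linarith), mul_zero]
      exact zero_le

/-- At `0` the multiplier tends to `w'(1) - 1`. -/
theorem tendsto_multiplier (hw : IsWeighting w) {d : EReal}
    (hd : HasExtDerivWithin w (Icc 0 1) 1 d) :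
    Tendsto (fun t => ((multiplier w t : ℝ) : EReal)) (𝓝[>] 0) (𝓝 (d - 1)) := by
  have hd' := (hw.tendsto_deriv hd).comp tendsto_exp_neg
  have hexp : Tendsto (fun t : ℝ => Real.exp (-t)) (𝓝[>] 0) (𝓝 1) :=
    tendsto_exp_neg.mono_right nhdsWithin_le_nhds
  have hv := hw.tendsto_expRenewal
  induction d with
  | bot =>
    have : ∀ᶠ t in 𝓝[>] (0 : ℝ), ((deriv w (Real.exp (-t)) : ℝ) : EReal) < (0 : ℝ) :=
      hd'.eventually_lt_const (EReal.bot_lt_coe 0)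
    obtain ⟨t, ht, ht0⟩ := (this.and self_mem_nhdsWithin).exists
    exact absurd (hw.deriv_nonneg (Real.exp_neg_mem_Ioo ht0)) (not_le.2 (EReal.coe_lt_coe_iff.1 ht))
  | coe d =>
    have h1 : Tendsto (fun t : ℝ => deriv w (Real.exp (-t))) (𝓝[>] 0) (𝓝 d) :=
      EReal.tendsto_coe.1 hd'
    have h2 := hexp.mul h1
    rw [one_mul] at h2
    have h3 := (h2.add (hw.tendsto_mconv_renewalDensity h2)).sub hv
    rw [add_zero] at h3
    have h4 : ((d : EReal) - 1) = ((d - 1 : ℝ) : EReal) := by norm_cast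
    rw [h4, EReal.tendsto_coe]
    refine h3.congr' ?_
    filter_upwards [self_mem_nhdsWithin] with t ht
    rw [multiplier, hw.renewalRate_eq ht]
  | top =>
    -- With infinite slope, `R ≥ A` already forces divergence, and the subtracted term stays
    -- bounded.
    have h1 : Tendsto (fun t : ℝ => deriv w (Real.exp (-t))) (𝓝[>] 0) atTop :=
      EReal.tendsto_coe_nhds_top_iff.1 hd'
    have h2 := hexp.pos_mul_atTop one_pos h1
    have h3 : Tendsto (multiplier w) (𝓝[>] 0) atTop := by
      have h4 : Tendsto (renewalRate w) (𝓝[>] 0) atTop := by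
        refine tendsto_atTop_mono' _ ?_ h2
        filter_upwards [self_mem_nhdsWithin] with t ht
        rw [hw.renewalRate_eq ht]
        exact le_add_of_nonneg_right ENNReal.toReal_nonneg
      exact (h4.atTop_add hv.neg).congr fun t => (sub_eq_add_neg _ _).symm
    have h5 : (⊤ : EReal) - 1 = ⊤ := EReal.top_sub_coe 1
    rw [h5]
    exact EReal.tendsto_coe_nhds_top_iff.2 h3

end IsWeighting

/-! ### Payment functions as measures -/

/-- `m` is the measure of payments over time whose cumulative payment function is `T`. -/
structure IsPaymentMeasure (m : Measure ℝ) (T : ℝ → ℝ) : Prop where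
  Iio_zero : m (Iio 0) = 0
  Iio_eq : ∀ t, 0 ≤ t → m (Iio t) = ENNReal.ofReal (T t)
  nonneg : ∀ t, 0 ≤ t → 0 ≤ T t

theorem IsPayment.exists_measure {T : ℝ → ℝ} (hT : IsPayment T) :
    ∃ m : Measure ℝ, SFinite m ∧ IsPaymentMeasure m T := by
  obtain ⟨f, time, lump, hf, hfi, htime, hlump, hsum⟩ := hT
  have hI : ∀ t, 0 ≤ t → 0 ≤ ∫ s in 0..t, f s := fun t ht =>
    intervalIntegral.integral_nonneg ht fun s _ => hf s
  have hterm : ∀ t i, 0 ≤ if time i < t then lump i else 0 := by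
    intro t i
    split_ifs
    exacts [hlump i, le_rfl]
  have hS : ∀ t, 0 ≤ t → 0 ≤ T t - ∫ s in 0..t, f s := fun t ht => (hsum t ht).nonneg (hterm t)
  have hT0 : T 0 = 0 := by
    have h := hsum 0 le_rfl
    simp only [not_lt.2 (htime _), if_false, intervalIntegral.integral_same, sub_zero] at h
    exact h.unique hasSum_zero
  -- A lump sum at `t_i` counts only for `t > t_i`, so `T(t)` is the mass of the open half-line `Iio
  -- t`, without a possible atom at `t`.
  let m : Measure ℝ := (volume.restrict (Ici 0)).withDensity (fun s => ENNReal.ofReal (f s))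
    + Measure.sum fun i => ENNReal.ofReal (lump i) • Measure.dirac (time i)
  have hm : ∀ t, 0 ≤ t → m (Iio t) = ENNReal.ofReal (T t) := by
    intro t ht
    have h1 : (volume.restrict (Ici 0)).withDensity (fun s => ENNReal.ofReal (f s)) (Iio t)
        = ENNReal.ofReal (∫ s in 0..t, f s) := by
      rw [withDensity_apply _ measurableSet_Iio, intervalIntegral.integral_of_le ht,
        ofReal_integral_eq_lintegral_ofReal (hfi t ht).1 (ae_of_all _ hf),
        Measure.restrict_restrict measurableSet_Iio, Iio_inter_Ici, restrict_Ico_eq_restrict_Ioc]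
    have h2 : (Measure.sum fun i => ENNReal.ofReal (lump i) • Measure.dirac (time i)) (Iio t)
        = ENNReal.ofReal (T t - ∫ s in 0..t, f s) := by
      rw [Measure.sum_apply _ measurableSet_Iio, ← (hsum t ht).tsum_eq,
        ENNReal.ofReal_tsum_of_nonneg (hterm t) (hsum t ht).summable]
      refine tsum_congr fun i => ?_
      rw [Measure.smul_apply, Measure.dirac_apply' _ measurableSet_Iio]
      by_cases h : time i < t <;> simp [h]
    rw [Measure.add_apply, h1, h2, ← ENNReal.ofReal_add (hI t ht) (hS t ht), add_sub_cancel]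
  refine ⟨m, inferInstance, ?_, hm, fun t ht => by linarith [hI t ht, hS t ht]⟩
  rw [hm 0 le_rfl, hT0, ENNReal.ofReal_zero]

namespace IsPaymentMeasure

variable {m : Measure ℝ} {T : ℝ → ℝ}

theorem mono (h : IsPaymentMeasure m T) {s t : ℝ} (hs : 0 ≤ s) (hst : s ≤ t) : T s ≤ T t := by
  have := measure_mono (μ := m) (Iio_subset_Iio hst)
  rwa [h.Iio_eq s hs, h.Iio_eq t (hs.trans hst),
    ENNReal.ofReal_le_ofReal_iff (h.nonneg t (hs.trans hst))] at this

theorem map_zero (h : IsPaymentMeasure m T) : T 0 = 0 := by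
  have := h.Iio_eq 0 le_rfl
  rw [h.Iio_zero, eq_comm, ENNReal.ofReal_eq_zero] at this
  exact le_antisymm this (h.nonneg 0 le_rfl)

theorem ae_nonneg (h : IsPaymentMeasure m T) : ∀ᵐ x ∂m, 0 ≤ x := by
  rw [ae_iff]
  simp only [not_le]
  exact h.Iio_zero

/-- Cumulative payments are left-continuous. -/
theorem exists_lt (h : IsPaymentMeasure m T) {s t y : ℝ} (hs : 0 ≤ s) (hst : s < t)
    (hy : y < T t) : ∃ t' ∈ Ioo s t, y < T t' := by
  obtain ⟨u, hu, hus, hlim⟩ := exists_seq_strictMono_tendsto' hst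
  have hU : ⋃ n, Iio (u n) = Iio t := by
    ext x
    simp only [mem_iUnion, mem_Iio]
    exact ⟨fun ⟨n, hn⟩ => hn.trans (hus n).2, fun hx => (hlim.eventually_const_lt hx).exists⟩
  have hm : ⨆ n, m (Iio (u n)) = m (Iio t) := by
    rw [← hU, Monotone.measure_iUnion fun _ _ hij => Iio_subset_Iio (hu.monotone hij)]
  by_contra! hcon
  have hle : m (Iio t) ≤ ENNReal.ofReal (max y (T s)) := by
    rw [← hm]
    refine iSup_le fun n => ?_
    rw [h.Iio_eq _ (hs.trans (hus n).1.le)]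
    exact ENNReal.ofReal_le_ofReal ((hcon _ (hus n)).trans (le_max_left _ _))
  have hu0 := hcon (u 0) (hus 0)
  rw [h.Iio_eq t (hs.trans hst.le), ENNReal.ofReal_le_ofReal_iff
    ((h.nonneg s hs).trans (le_max_right _ _)),
    max_eq_left ((h.mono hs (hus 0).1.le).trans hu0)] at hle
  exact hle.not_gt hy

/-- Monotonicity makes the set an up-set, and left-continuity makes it open. On such half-lines the
distorted probability agrees with a genuine measure. -/
theorem eq_empty_or_eq_Ioi (h : IsPaymentMeasure m T) {s : ℝ} (hs : 0 ≤ s) (y : ℝ) :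
    {c | 0 < c ∧ y < T (s + c) - T s} = ∅ ∨
      ∃ c₀, 0 ≤ c₀ ∧ {c | 0 < c ∧ y < T (s + c) - T s} = Ioi c₀ := by
  set S : Set ℝ := {c | 0 < c ∧ y < T (s + c) - T s} with hS
  rcases S.eq_empty_or_nonempty with h0 | hne
  · exact Or.inl h0
  have hlb : (0 : ℝ) ∈ lowerBounds S := fun c hc => hc.1.le
  refine Or.inr ⟨sInf S, le_csInf hne fun c hc => hlb hc, ?_⟩
  ext c
  rw [mem_Ioi, csInf_lt_iff ⟨0, hlb⟩ hne]
  constructor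
  · intro hc
    obtain ⟨t', ht', hy⟩ := h.exists_lt hs (show s < s + c by linarith [hc.1])
      (show y + T s < T (s + c) by linarith [hc.2])
    refine ⟨t' - s, ⟨by linarith [ht'.1], ?_⟩, by linarith [ht'.2]⟩
    rw [add_sub_cancel]
    linarith
  · rintro ⟨b, hb, hbc⟩
    refine ⟨hb.1.trans hbc, hb.2.trans_le ?_⟩
    linarith [h.mono (add_nonneg hs hb.1.le) (show s + b ≤ s + c by linarith)]

/-- Layer-cake formula for the payments made in a random time span. -/
theorem lintegral_measure_eq [SFinite m] (h : IsPaymentMeasure m T) (κ : Measure ℝ) [SFinite κ]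
    {s : ℝ} (hs : 0 ≤ s) :
    ∫⁻ y in Ioi (0 : ℝ), κ {c | 0 < c ∧ y < T (s + c) - T s}
      = ∫⁻ x, survival κ (x - s) ∂m := by
  set φ : ℝ → ℝ := fun c => T (s + max c 0) - T s with hφ
  have hmono : Monotone φ := fun a b hab => by
    simp only [hφ]
    have := h.mono (add_nonneg hs (le_max_right a 0))
      (add_le_add_right (max_le_max_right 0 hab) s)
    linarith
  have hnn : ∀ c, 0 ≤ φ c := fun c =>
    sub_nonneg.2 (h.mono hs (le_add_of_nonneg_right (le_max_right c 0)))
  have h1 := lintegral_eq_lintegral_meas_lt κ (ae_of_all _ hnn) hmono.measurable.aemeasurable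
  have h2 : ∀ y ∈ Ioi (0 : ℝ), κ {c | y < φ c} = κ {c | 0 < c ∧ y < T (s + c) - T s} := by
    intro y hy
    congr 1
    ext c
    simp only [mem_ofPred_eq, hφ]
    rcases le_or_gt c 0 with hc | hc
    · simp [max_eq_right hc, not_lt.2 hc, (mem_Ioi.1 hy).le]
    · simp [max_eq_left hc.le, hc]
  rw [← setLIntegral_congr_fun measurableSet_Ioi h2, ← h1]
  -- The amount paid during `[s, s + c)` is a mass of `m`. After Tonelli, a payment at `x ≥ s`
  -- counts exactly when `c > x - s`.
  have h3 : ∀ c, ENNReal.ofReal (φ c) = ∫⁻ x, (Ico s (s + c)).indicator 1 x ∂m := by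
    intro c
    rw [lintegral_indicator_one measurableSet_Ico]
    rcases le_or_gt c 0 with hc | hc
    · simp [hφ, hc]
    · have : Iio (s + c) \ Iio s = Ico s (s + c) := by
        ext x; simp
      rw [← this, measure_sdiff (Iio_subset_Iio (by linarith)) measurableSet_Iio.nullMeasurableSet
        (by rw [h.Iio_eq s hs]; exact ENNReal.ofReal_ne_top), h.Iio_eq s hs,
        h.Iio_eq _ (by linarith), ← ENNReal.ofReal_sub _ (h.nonneg s hs)]
      simp only [hφ, max_eq_left hc.le]
  simp only [h3]
  rw [lintegral_lintegral_swap]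
  · refine lintegral_congr fun x => ?_
    rcases lt_or_ge x s with hx | hx
    · rw [survival_of_neg _ (by linarith)]
      refine (lintegral_congr fun c => ?_).trans lintegral_zero
      exact indicator_of_notMem (by simp [hx]) _
    · rw [survival_of_nonneg _ (by linarith), ← lintegral_indicator_one measurableSet_Ioi]
      refine lintegral_congr fun c => ?_
      simp [indicator_apply, hx, sub_lt_iff_lt_add']
  · have : MeasurableSet {z : ℝ × ℝ | s ≤ z.2 ∧ z.2 < s + z.1} :=
      (measurableSet_le measurable_const measurable_snd).inter
        (measurableSet_lt measurable_snd (measurable_const.add measurable_fst))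
    exact ((measurable_one.indicator this : Measurable
      ({z : ℝ × ℝ | s ≤ z.2 ∧ z.2 < s + z.1}.indicator (1 : ℝ × ℝ → ℝ≥0∞)))).aemeasurable

end IsPaymentMeasure

/-! ### Linearity of the perceived cost and of the profit -/

section

variable {Ω : Type*} [MeasurableSpace Ω] {P : Measure Ω} {τ : Ω → ℝ} {w T : ℝ → ℝ} {m : Measure ℝ}

/-- By memorylessness the half-line `(c, ∞)` of remaining times has conditional probability
`e^{-c}`, and `w(e^{-c})` is its mass under the delay law. The distorted integral is thus an
ordinary expectation for that law. -/
theorem perceivedCost_eq [SFinite m] (hw : IsWeighting w) (hτ : IsExpTime P τ)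
    (hm : IsPaymentMeasure m T) (lam : ℝ) {s : ℝ} (hs : 0 ≤ s) :
    perceivedCost P τ w lam T s = ENNReal.ofReal lam *
      ∫⁻ x, survival (volume.withDensity (weightDensity w)) (x - s) ∂m := by
  rw [perceivedCost, ← hm.lintegral_measure_eq _ hs]
  congr 1
  refine setLIntegral_congr_fun measurableSet_Ioi fun y hy => ?_
  have hms : MeasurableSet {ω | s < τ ω} := measurableSet_lt measurable_const hτ.measurable
  have hset : {ω | s < τ ω} ∩ {ω | y < T (τ ω) - T s}
      = {ω | τ ω - s ∈ {c | 0 < c ∧ y < T (s + c) - T s}} := by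
    ext ω
    simp
  simp only [measureReal_def]
  rw [ProbabilityTheory.cond_apply hms, hset, hτ.tail s hs]
  rcases hm.eq_empty_or_eq_Ioi hs y with h | ⟨c, hc, h⟩
  · rw [h]
    simp [hw.map_zero]
  · rw [h, hw.withDensity_Ioi hc]
    have h1 : {ω | τ ω - s ∈ Ioi c} = {ω | s + c < τ ω} := by
      ext ω
      simp [lt_sub_iff_add_lt']
    rw [h1, hτ.tail _ (by linarith), ENNReal.toReal_mul, ENNReal.toReal_inv,
      ENNReal.toReal_ofReal (Real.exp_pos _).le, ENNReal.toReal_ofReal (Real.exp_pos _).le,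
      ← Real.exp_neg, ← Real.exp_add]
    congr 3
    ring

theorem profit_eq [SFinite m] [IsProbabilityMeasure P] (hτ : IsExpTime P τ)
    (hm : IsPaymentMeasure m T) :
    profit P τ T = ∫⁻ x, ENNReal.ofReal (Real.exp (-x)) ∂m := by
  have hpos : ∀ᵐ ω ∂P, 0 < τ ω := by
    have h := hτ.tail 0 le_rfl
    rw [neg_zero, Real.exp_zero, ENNReal.ofReal_one] at h
    exact (mem_ae_iff_prob_eq_one (measurableSet_lt measurable_const hτ.measurable)).2 h
  have h1 : ∀ x, 0 ≤ x → survival (P.map τ) (x - 0) = ENNReal.ofReal (Real.exp (-x)) := by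
    intro x hx
    rw [sub_zero, survival_of_nonneg _ hx, Measure.map_apply hτ.measurable measurableSet_Ioi]
    exact hτ.tail x hx
  rw [profit, ← lintegral_congr_ae (hm.ae_nonneg.mono h1), ← hm.lintegral_measure_eq _ le_rfl]
  refine setLIntegral_congr_fun measurableSet_Ioi fun y hy => ?_
  have hS : MeasurableSet {c | 0 < c ∧ y < T (0 + c) - T 0} := by
    rcases hm.eq_empty_or_eq_Ioi le_rfl y with h | ⟨c, -, h⟩
    · rw [h]; exact MeasurableSet.empty
    · rw [h]; exact measurableSet_Ioi
  rw [Measure.map_apply hτ.measurable hS]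
  refine measure_congr ?_
  filter_upwards [hpos] with ω hω
  refine propext ?_
  change y < T (τ ω) ↔ 0 < τ ω ∧ y < T (0 + τ ω) - T 0
  simp [hω, hm.map_zero]

end

/-! ### The first zero of the multiplier and the inequality beyond it -/

namespace IsWeighting

variable {w : ℝ → ℝ}

theorem multiplier_pos_near_zero (hw : IsWeighting w) : ∀ᶠ t in 𝓝[>] 0, 0 < multiplier w t := by
  obtain ⟨d, hd, hd1⟩ := hw.slope_one
  have h0 : ((0 : ℝ) : EReal) < d - 1 := by
    rw [EReal.coe_zero]
    exact EReal.sub_pos.2 hd1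
  filter_upwards [(hw.tendsto_multiplier hd).eventually_const_lt h0] with t ht
  exact EReal.coe_lt_coe_iff.1 ht

/-- The multiplier vanishes no later than at the fixed point of the weighting function. -/
theorem exists_isLeast_multiplier_nonpos (hw : IsWeighting w) {p : ℝ} (hp : p ∈ Ioo (0 : ℝ) 1)
    (hwp : w p = p) :
    ∃ t₀, IsLeast {t | t ∈ Ioc 0 (-Real.log p) ∧ multiplier w t ≤ 0} t₀ := by
  set t₁ := -Real.log p with ht₁
  have ht₁0 : 0 < t₁ := neg_pos.2 (Real.log_neg hp.1 hp.2)
  obtain ⟨δ, hδ, hδ'⟩ := mem_nhdsGT_iff_exists_Ioo_subset.1 hw.multiplier_pos_near_zero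
  -- A multiplier positive on `(0, t₁]` would make the integral at `t₁` positive, but it equals `p -
  -- w(p) = 0`.
  have hne : ∃ t ∈ Ioc 0 t₁, multiplier w t ≤ 0 := by
    by_contra! hcon
    have h1 := hw.integral_kernel_mul_multiplier ht₁0.le
    have h2 : Real.exp (-t₁) = p := by rw [ht₁, neg_neg, Real.exp_log hp.1]
    rw [h2, hwp, sub_self] at h1
    have h3 : 0 < ∫ s in 0..t₁, w (Real.exp (-t₁ + s)) * multiplier w s := by
      refine intervalIntegral.intervalIntegral_pos_of_pos_on
        (hw.intervalIntegrable_kernel_mul ht₁0.le le_rfl (hw.intervalIntegrable_multiplier 0 t₁))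
        (fun s hs => mul_pos (hw.pos ⟨Real.exp_pos _, ?_⟩) (hcon s ⟨hs.1, hs.2.le⟩)) ht₁0
      exact Real.exp_le_one_iff.2 (by linarith [hs.2])
    linarith
  have hset : {t | t ∈ Ioc 0 t₁ ∧ multiplier w t ≤ 0}
      = Icc δ t₁ ∩ multiplier w ⁻¹' Iic 0 := by
    ext t
    constructor
    · rintro ⟨ht, htm⟩
      refine ⟨⟨?_, ht.2⟩, htm⟩
      by_contra! h
      exact not_lt.2 htm (hδ' ⟨ht.1, h⟩)
    · rintro ⟨ht, htm⟩
      exact ⟨⟨(mem_Ioi.1 hδ).trans_le ht.1, ht.2⟩, htm⟩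
  have hc : IsCompact (Icc δ t₁ ∩ multiplier w ⁻¹' Iic 0) :=
    isCompact_Icc.of_isClosed_subset ((hw.continuousOn_multiplier.mono fun t ht =>
      (mem_Ioi.1 hδ).trans_le ht.1).preimage_isClosed_of_isClosed isClosed_Icc isClosed_Iic)
      inter_subset_left
  obtain ⟨t, ht⟩ := hne
  rw [hset]
  exact hc.exists_isLeast ⟨t, hset ▸ ht⟩

/-- The interpolation inequality along `x ↦ w(e^{s-x})`, with coefficients independent of `s`. -/
theorem interpolation_exp_lt (hw : IsWeighting w) {s t₀ y x : ℝ} (hs : s ≤ t₀) (hy : t₀ < y)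
    (hx : y < x) :
    Real.exp (-x) * (Real.exp (-t₀) - Real.exp (-x)) /
        (Real.exp (-y) * (Real.exp (-t₀) - Real.exp (-y))) * w (Real.exp (-y + s))
      - Real.exp (-x) * (Real.exp (-y) - Real.exp (-x)) /
        (Real.exp (-t₀) * (Real.exp (-t₀) - Real.exp (-y))) * w (Real.exp (-t₀ + s))
      < w (Real.exp (-x + s)) := by
  have h := hw.interpolation_lt (q := Real.exp (-x + s)) (p := Real.exp (-y + s))
    (b := Real.exp (-t₀ + s)) (Real.exp_pos _) (Real.exp_lt_exp.2 (by linarith))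
    (Real.exp_lt_exp.2 (by linarith)) (Real.exp_le_one_iff.2 (by linarith))
  have hE := (Real.exp_pos s).ne'
  -- The interpolation coefficients are homogeneous of degree `0`, so the common factor `e^s`
  -- cancels. One pair of coefficients thus serves all `s`, and the inequality can be integrated
  -- against the multiplier.
  have hd : ∀ a b c d : ℝ, a * Real.exp s * (b * Real.exp s - c * Real.exp s)
      / (d * Real.exp s * (b * Real.exp s - d * Real.exp s)) = a * (b - c) / (d * (b - d)) := by
    intro a b c d
    rw [← sub_mul, ← sub_mul, mul_mul_mul_comm, mul_mul_mul_comm d,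
      mul_div_mul_right _ _ (mul_ne_zero hE hE)]
  have hd' : ∀ a b c d : ℝ, a * Real.exp s * (b * Real.exp s - c * Real.exp s)
      / (d * Real.exp s * (d * Real.exp s - b * Real.exp s)) = a * (b - c) / (d * (d - b)) := by
    intro a b c d
    rw [← sub_mul, ← sub_mul, mul_mul_mul_comm, mul_mul_mul_comm d,
      mul_div_mul_right _ _ (mul_ne_zero hE hE)]
  rw [← hd, ← hd']
  simpa only [Real.exp_add] using h

/-- After `t₀` the multiplier on `[0, t₀]` overcompensates the expected payment. -/
theorem exp_neg_lt_kernel_add_integral (hw : IsWeighting w) {t₀ : ℝ} (ht₀ : 0 < t₀)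
    (hpos : ∀ s ∈ Ioo 0 t₀, 0 < multiplier w s) (hzero : multiplier w t₀ ≤ 0) {x : ℝ}
    (hx : t₀ < x) :
    Real.exp (-x) <
      w (Real.exp (-x)) + ∫ s in 0..t₀, w (Real.exp (-x + s)) * multiplier w s := by
  have hgi := hw.intervalIntegrable_multiplier
  -- `F` is the slack in the dual constraint when the multiplier is stopped at `t₀`; it vanishes at
  -- `t₀`.
  set F : ℝ → ℝ := fun x => w (Real.exp (-x)) +
    (∫ s in 0..t₀, w (Real.exp (-x + s)) * multiplier w s) - Real.exp (-x) with hF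
  have hFt₀ : F t₀ = 0 := by
    simp only [hF]
    rw [hw.integral_kernel_mul_multiplier ht₀.le]
    ring
  have hstep : ∀ y x, t₀ < y → y < x →
      Real.exp (-x) * (Real.exp (-t₀) - Real.exp (-x)) /
        (Real.exp (-y) * (Real.exp (-t₀) - Real.exp (-y))) * F y < F x := by
    intro y x hy hyx
    set a := Real.exp (-x) * (Real.exp (-t₀) - Real.exp (-x)) /
        (Real.exp (-y) * (Real.exp (-t₀) - Real.exp (-y))) with ha
    set b := Real.exp (-x) * (Real.exp (-y) - Real.exp (-x)) /
        (Real.exp (-t₀) * (Real.exp (-t₀) - Real.exp (-y))) with hb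
    have hlt : Real.exp (-y) < Real.exp (-t₀) := Real.exp_lt_exp.2 (by linarith)
    -- Interpolation is exact for the identity. Subtracting this from the interpolation inequalities
    -- for the `w`-terms, integrated against `multiplier w > 0`, gives `a F(y) - b F(t₀) < F(x)`.
    have hlin : Real.exp (-x) = a * Real.exp (-y) - b * Real.exp (-t₀) := by
      have h1 := (sub_pos.2 hlt).ne'
      have h2 := (Real.exp_pos (-y)).ne'
      have h3 := (Real.exp_pos (-t₀)).ne'
      rw [ha, hb]
      field_simp
      ring
    have h0 := hw.interpolation_exp_lt ht₀.le hy hyx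
    simp only [add_zero] at h0
    rw [← ha, ← hb] at h0
    have iy := hw.intervalIntegrable_kernel_mul (t := y) (by linarith) hy.le (hgi 0 t₀)
    have it := hw.intervalIntegrable_kernel_mul (t := t₀) ht₀.le le_rfl (hgi 0 t₀)
    have ix := hw.intervalIntegrable_kernel_mul (t := x) (by linarith) (hy.trans hyx).le (hgi 0 t₀)
    have hI : a * (∫ s in 0..t₀, w (Real.exp (-y + s)) * multiplier w s)
        - b * (∫ s in 0..t₀, w (Real.exp (-t₀ + s)) * multiplier w s)
        ≤ ∫ s in 0..t₀, w (Real.exp (-x + s)) * multiplier w s := by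
      rw [← intervalIntegral.integral_const_mul, ← intervalIntegral.integral_const_mul,
        ← intervalIntegral.integral_sub (iy.const_mul a) (it.const_mul b)]
      refine intervalIntegral.integral_mono_on_of_le_Ioo ht₀.le
        ((iy.const_mul a).sub (it.const_mul b)) ix fun s hs => ?_
      have h1 := hw.interpolation_exp_lt hs.2.le hy hyx
      rw [← ha, ← hb] at h1
      calc a * (w (Real.exp (-y + s)) * multiplier w s)
            - b * (w (Real.exp (-t₀ + s)) * multiplier w s)
          = (a * w (Real.exp (-y + s)) - b * w (Real.exp (-t₀ + s))) * multiplier w s := by ring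
        _ ≤ w (Real.exp (-x + s)) * multiplier w s :=
          mul_le_mul_of_nonneg_right h1.le (hpos s hs).le
    have h4 : a * F y = a * F y - b * F t₀ := by rw [hFt₀, mul_zero, sub_zero]
    rw [h4]
    simp only [hF]
    linarith
  have hnn : ∀ x, t₀ < x → 0 ≤ F x := by
    intro x hx
    -- Let `y` be close to `t₀` from above. The multiplier is below `ε` on `[t₀, y]` because it is
    -- continuous and nonpositive at `t₀`, so stopping it there costs at most `ε (y - t₀)`. The
    -- coefficient `a` grows only like `1 / (y - t₀)`, and `e^{2x}` is a crude bound for `a (y -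
    -- t₀)`.
    have hlow : ∀ ε > 0, -(Real.exp x * Real.exp x) * ε ≤ F x := by
      intro ε hε
      have hev : ∀ᶠ s in 𝓝 t₀, multiplier w s < ε :=
        (hw.continuousOn_multiplier.continuousAt (Ioi_mem_nhds ht₀)).eventually_lt_const
          (hzero.trans_lt hε)
      obtain ⟨δ, hδ, hδ'⟩ := Metric.eventually_nhds_iff.1 hev
      obtain ⟨y, hy, hyx⟩ := exists_between (show t₀ < min x (t₀ + δ) from
        lt_min hx (by linarith))
      have hyx' : y < x := hyx.trans_le (min_le_left _ _)
      have hyδ : y < t₀ + δ := hyx.trans_le (min_le_right _ _)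
      have hFy : -(ε * (y - t₀)) ≤ F y := by
        have h1 := hw.integral_kernel_mul_multiplier (ht₀.trans hy).le
        have i1 := hw.intervalIntegrable_kernel_mul (t := y) (by linarith) hy.le (hgi 0 t₀)
        have i2 := hw.intervalIntegrable_kernel_mul (t := y) hy.le le_rfl (hgi t₀ y)
        rw [← intervalIntegral.integral_add_adjacent_intervals i1 i2] at h1
        have h2 : ∫ s in t₀..y, w (Real.exp (-y + s)) * multiplier w s ≤ ∫ s in t₀..y, ε := by
          refine intervalIntegral.integral_mono_on hy.le i2 (by simp) fun s hs => ?_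
          have h3 : multiplier w s < ε := hδ' (by
            rw [Real.dist_eq, abs_of_nonneg (by linarith [hs.1])]; linarith [hs.2])
          have hk0 := hw.kernel_nonneg hs.2
          have hk1 := hw.kernel_le_one hs.2
          nlinarith
        rw [intervalIntegral.integral_const, smul_eq_mul] at h2
        simp only [hF]
        linarith
      refine le_trans ?_ (hstep y x hy hyx').le
      set a := Real.exp (-x) * (Real.exp (-t₀) - Real.exp (-x)) /
        (Real.exp (-y) * (Real.exp (-t₀) - Real.exp (-y))) with ha
      have hlt : Real.exp (-y) < Real.exp (-t₀) := Real.exp_lt_exp.2 (by linarith)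
      have hltx : Real.exp (-x) < Real.exp (-t₀) := Real.exp_lt_exp.2 (by linarith)
      have hxy : Real.exp (-x) ≤ Real.exp (-y) := Real.exp_le_exp.2 (by linarith)
      have ha0 : 0 ≤ a := div_nonneg (mul_nonneg (Real.exp_pos _).le (sub_pos.2 hltx).le)
        (mul_nonneg (Real.exp_pos _).le (sub_pos.2 hlt).le)
      have hgap : Real.exp (-y) * (y - t₀) ≤ Real.exp (-t₀) - Real.exp (-y) := by
        have h1 := Real.add_one_le_exp (y - t₀)
        have h2 : Real.exp (-t₀) = Real.exp (-y) * Real.exp (y - t₀) := by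
          rw [← Real.exp_add]; congr 1; ring
        nlinarith [Real.exp_pos (-y)]
      have hale : a * (y - t₀) ≤ Real.exp x * Real.exp x := by
        rw [ha, div_mul_eq_mul_div, div_le_iff₀ (mul_pos (Real.exp_pos _) (sub_pos.2 hlt))]
        have hx1 : Real.exp x * Real.exp (-x) = 1 := by rw [← Real.exp_add]; simp
        have h1 : Real.exp (-x) * (Real.exp (-t₀) - Real.exp (-x)) ≤ 1 :=
          mul_le_one₀ (Real.exp_neg_mem_Ioc (by linarith)).2 (sub_pos.2 hltx).le
            (by linarith [Real.exp_pos (-x), (Real.exp_neg_mem_Ioc ht₀.le).2])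
        have h2 : 1 ≤ Real.exp x * Real.exp (-y) := by
          rw [← hx1]; exact mul_le_mul_of_nonneg_left hxy (Real.exp_pos _).le
        calc Real.exp (-x) * (Real.exp (-t₀) - Real.exp (-x)) * (y - t₀)
            ≤ 1 * (y - t₀) := mul_le_mul_of_nonneg_right h1 (sub_pos.2 hy).le
          _ ≤ (Real.exp x * Real.exp (-y)) * (Real.exp x * Real.exp (-y)) * (y - t₀) :=
              mul_le_mul_of_nonneg_right (by nlinarith) (sub_pos.2 hy).le
          _ = Real.exp x * Real.exp x * (Real.exp (-y) * (Real.exp (-y) * (y - t₀))) := by ring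
          _ ≤ _ := by
              gcongr
      nlinarith [mul_le_mul_of_nonneg_left hFy ha0]
    by_contra! hneg
    have hE : 0 < Real.exp x * Real.exp x := by positivity
    have := hlow (-F x / (2 * (Real.exp x * Real.exp x))) (div_pos (by linarith) (by linarith))
    have h2 : -(Real.exp x * Real.exp x) * (-F x / (2 * (Real.exp x * Real.exp x))) = F x / 2 := by
      field_simp
    linarith
  -- Strictness comes from one more interpolation step, from an intermediate `y` with `F(y) ≥ 0`.
  obtain ⟨y, hy, hyx⟩ := exists_between hx
  have hlt : Real.exp (-y) < Real.exp (-t₀) := Real.exp_lt_exp.2 (by linarith)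
  have hltx : Real.exp (-x) < Real.exp (-t₀) := Real.exp_lt_exp.2 (by linarith)
  have h1 := hstep y x hy hyx
  have h2 := mul_nonneg (div_nonneg (mul_nonneg (Real.exp_pos (-x)).le (sub_pos.2 hltx).le)
    (mul_nonneg (Real.exp_pos (-y)).le (sub_pos.2 hlt).le)) (hnn y hy)
  have h3 := h2.trans_lt h1
  simp only [hF] at h3
  linarith

/-! ### Existence and uniqueness for the two equations -/

/-- The solution of the binding equation. -/
theorem solvesBindingEq (hw : IsWeighting w) {t₀ : ℝ} (ht₀ : 0 ≤ t₀) :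
    SolvesBindingEq w t₀ fun s => renewalRate w (t₀ - s) := by
  constructor
  · have := (hw.intervalIntegrable_renewalRate t₀ 0).comp_sub_left t₀
    rw [sub_self, sub_zero] at this
    exact (intervalIntegrable_iff_integrableOn_Icc_of_le ht₀).1 this
  · intro t ht
    have h := hw.kernel_add_integral_renewalRate (sub_nonneg.2 ht.2)
    have h2 := intervalIntegral.integral_comp_sub_left (a := t) (b := t₀)
      (fun u => w (Real.exp (-(t₀ - t) + u)) * renewalRate w u) t₀
    rw [sub_self] at h2
    rw [← h2] at h
    convert h using 3
    · congr 1; ring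
    · ext s
      congr 3
      ring

/-- Reversing time at `t₀` turns the binding equation into a convolution equation that the renewal
rate also solves, and convolution with the kernel is injective. -/
theorem ae_eq_of_solvesBindingEq (hw : IsWeighting w) {t₀ : ℝ} (ht₀ : 0 ≤ t₀) {f : ℝ → ℝ}
    (hf : SolvesBindingEq w t₀ f) :
    f =ᵐ[volume.restrict (Icc 0 t₀)] fun s => renewalRate w (t₀ - s) := by
  have hfi : IntervalIntegrable f volume t₀ 0 :=
    ((intervalIntegrable_iff_integrableOn_Icc_of_le ht₀).2 hf.1).symm
  have hfi' := hfi.comp_sub_left t₀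
  rw [sub_self, sub_zero] at hfi'
  have hri := hw.intervalIntegrable_renewalRate
  have h0 := hw.ae_eq_zero_of_kernel_integral_eq_zero (T := t₀)
    (h := fun u => f (t₀ - u) - renewalRate w u)
    ((intervalIntegrable_iff_integrableOn_Icc_of_le ht₀).1 (hfi'.sub (hri 0 t₀))) ?_
  · have h1 := (ae_restrict_iff' measurableSet_Icc).1 h0
    have h2 := (quasiMeasurePreserving_sub_left_of_right_invariant volume t₀).ae h1
    refine (ae_restrict_iff' measurableSet_Icc).2 ?_
    filter_upwards [h2] with s hs hst
    have := hs ⟨by linarith [hst.2], by linarith [hst.1]⟩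
    simp only [sub_sub_cancel, Pi.zero_apply] at this
    exact sub_eq_zero.1 this
  · intro t ht
    have hft : IntervalIntegrable (fun u => f (t₀ - u)) volume 0 t :=
      hfi'.mono_set (by rw [uIcc_of_le ht.1, uIcc_of_le ht₀]; exact Icc_subset_Icc_right ht.2)
    have h := hw.kernel_add_integral_renewalRate ht.1
    have h3 := hf.2 (t₀ - t) ⟨by linarith [ht.2], by linarith [ht.1]⟩
    have h2 := intervalIntegral.integral_comp_sub_left (a := 0) (b := t)
      (fun s => w (Real.exp (-s + (t₀ - t))) * f s) t₀
    rw [sub_zero] at h2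
    rw [← h2] at h3
    have e1 : -t₀ + (t₀ - t) = -t := by ring
    have e2 : ∀ u, -(t₀ - u) + (t₀ - t) = -t + u := fun u => by ring
    simp only [e1, e2] at h3
    simp only [mul_sub]
    rw [intervalIntegral.integral_sub (hw.intervalIntegrable_kernel_mul ht.1 le_rfl hft)
      (hw.intervalIntegrable_kernel_mul ht.1 le_rfl (hri 0 t))]
    linarith

theorem solvesMultiplierEq (hw : IsWeighting w) {t₁ : ℝ} (ht₁ : 0 ≤ t₁) :
    SolvesMultiplierEq w t₁ (multiplier w) := by
  refine ⟨(intervalIntegrable_iff_integrableOn_Icc_of_le ht₁).1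
    (hw.intervalIntegrable_multiplier 0 t₁), fun t ht => ?_⟩
  rw [hw.integral_kernel_mul_multiplier ht.1, sub_self]

theorem ae_eq_of_solvesMultiplierEq (hw : IsWeighting w) {t₁ : ℝ} (ht₁ : 0 ≤ t₁) {g : ℝ → ℝ}
    (hg : SolvesMultiplierEq w t₁ g) :
    g =ᵐ[volume.restrict (Icc 0 t₁)] multiplier w := by
  have hm := hw.solvesMultiplierEq ht₁
  have h0 := hw.ae_eq_zero_of_kernel_integral_eq_zero (T := t₁)
    (h := fun s => g s - multiplier w s) (hg.1.sub hm.1) ?_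
  · exact h0.mono fun s hs => sub_eq_zero.1 hs
  · intro t ht
    have hgt : IntervalIntegrable g volume 0 t :=
      (intervalIntegrable_iff_integrableOn_Icc_of_le ht.1).2
        (hg.1.mono_set (Icc_subset_Icc_right ht.2))
    simp only [mul_sub]
    rw [intervalIntegral.integral_sub (hw.intervalIntegrable_kernel_mul ht.1 le_rfl hgt)
      (hw.intervalIntegrable_kernel_mul ht.1 le_rfl (hw.intervalIntegrable_multiplier 0 t))]
    linarith [hg.2 t ht, hm.2 t ht]

end IsWeighting

/-! ### The candidate, the multiplier measure and duality -/

/-- The distorted expectation at time `s` of the payments still to come under the payment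
measure `m`. -/
noncomputable def futureCost (w : ℝ → ℝ) (m : Measure ℝ) (s : ℝ) : ℝ≥0∞ :=
  ∫⁻ x, survival (volume.withDensity (weightDensity w)) (x - s) ∂m

/-- The payment measure of the optimal payment function. -/
noncomputable def starMeasure (w : ℝ → ℝ) (c t₀ : ℝ) : Measure ℝ :=
  ENNReal.ofReal c • ((volume.restrict (Ici 0)).withDensity
    (fun x => renewalDensity (weightDensity w) (t₀ - x)) + Measure.dirac t₀)

/-- The absolutely continuous part of the multiplier of the rationality constraints. -/
noncomputable def multiplierMeasure (w : ℝ → ℝ) (t₀ : ℝ) : Measure ℝ :=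
  volume.withDensity ((Ioo 0 t₀).indicator fun s => ENNReal.ofReal (multiplier w s))

/-- Two payment functions that agree almost everywhere on `(0, t₀)` agree on `(0, t₀]`. -/
theorem IsPaymentMeasure.le_of_ae_eq {m₁ m₂ : Measure ℝ} {T₁ T₂ : ℝ → ℝ}
    (h₁ : IsPaymentMeasure m₁ T₁) (h₂ : IsPaymentMeasure m₂ T₂) {t₀ : ℝ}
    (hae : ∀ᵐ x, x ∈ Ioo 0 t₀ → T₁ x = T₂ x) {t : ℝ} (ht : t ∈ Ioc 0 t₀) : T₁ t ≤ T₂ t := by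
  by_contra! hlt
  -- By left-continuity `T₁` exceeds `T₂ t` on a whole interval before `t`, while `T₂` stays at most
  -- `T₂ t` there. Equality at a single point of that interval is contradictory.
  obtain ⟨t', ht', hlt'⟩ := h₁.exists_lt le_rfl ht.1 hlt
  have hne : (ae (volume.restrict (Ioo t' t))).NeBot := by
    rw [ae_restrict_neBot, Real.volume_Ioo]
    simpa using ht'.2
  have hae' : ∀ᵐ x ∂volume.restrict (Ioo t' t), x ∈ Ioo 0 t₀ → T₁ x = T₂ x :=
    ae_restrict_of_ae hae
  obtain ⟨x, hx, hxm⟩ := (hae'.and (ae_restrict_mem measurableSet_Ioo)).exists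
  have h3 := hx ⟨ht'.1.trans hxm.1, hxm.2.trans_le ht.2⟩
  have h4 := h₁.mono ht'.1.le hxm.1.le
  have h5 := h₂.mono (ht'.1.trans hxm.1).le hxm.2.le
  linarith

namespace IsWeighting

variable {w : ℝ → ℝ} {t₀ c : ℝ}

theorem intervalIntegrable_renewalRate_sub (hw : IsWeighting w) (t₀ a b : ℝ) :
    IntervalIntegrable (fun s => renewalRate w (t₀ - s)) volume a b := by
  have := (hw.intervalIntegrable_renewalRate (t₀ - a) (t₀ - b)).comp_sub_left t₀
  rwa [sub_sub_cancel, sub_sub_cancel] at this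

theorem integral_renewalRate_sub (hw : IsWeighting w) (t₀ t : ℝ) :
    ∫ s in 0..min t t₀, renewalRate w (t₀ - s) = ∫ s in 0..t, renewalRate w (t₀ - s) := by
  rcases le_or_gt t t₀ with h | h
  · rw [min_eq_left h]
  · have hi := hw.intervalIntegrable_renewalRate_sub t₀
    rw [min_eq_right h.le, ← intervalIntegral.integral_add_adjacent_intervals (hi 0 t₀) (hi t₀ t),
      left_eq_add, ← intervalIntegral.integral_zero (a := t₀) (b := t)]
    refine intervalIntegral.integral_congr fun s hs => ?_
    rw [uIcc_of_le h.le] at hs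
    simp only [renewalRate]
    rw [hw.isDelayDensity.renewalDensity_eq_zero (by linarith [hs.1]), ENNReal.toReal_zero]

theorem isPayment_star (hw : IsWeighting w) {θ lam : ℝ} (hθ : 0 ≤ θ) (hlam : 0 < lam)
    (ht₀ : 0 ≤ t₀) : IsPayment (starPayment θ lam t₀ fun s => renewalRate w (t₀ - s)) := by
  have hc : 0 ≤ θ / lam := div_nonneg hθ hlam.le
  refine ⟨fun s => θ / lam * renewalRate w (t₀ - s), fun _ => t₀,
    fun i => if i = 0 then θ / lam else 0, fun s => mul_nonneg hc (renewalRate_nonneg w _),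
    fun t _ => (hw.intervalIntegrable_renewalRate_sub t₀ 0 t).const_mul _, fun _ => ht₀,
    fun i => ?_, fun t _ => ?_⟩
  · dsimp only
    split_ifs
    exacts [hc, le_rfl]
  · have h : starPayment θ lam t₀ (fun s => renewalRate w (t₀ - s)) t
        - ∫ s in 0..t, θ / lam * renewalRate w (t₀ - s)
        = if t₀ < t then (if (0 : ℕ) = 0 then θ / lam else 0) else 0 := by
      rw [starPayment, hw.integral_renewalRate_sub, intervalIntegral.integral_const_mul,
        if_pos rfl]
      split_ifs <;> ring
    rw [h]
    exact hasSum_single 0 fun i hi => by simp [hi]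

theorem isPaymentMeasure_star (hw : IsWeighting w) {θ lam : ℝ} (hθ : 0 ≤ θ) (hlam : 0 < lam)
    (ht₀ : 0 ≤ t₀) : IsPaymentMeasure (starMeasure w (θ / lam) t₀)
      (starPayment θ lam t₀ fun s => renewalRate w (t₀ - s)) := by
  have hc : 0 ≤ θ / lam := div_nonneg hθ hlam.le
  have hI : ∀ t, 0 ≤ t → 0 ≤ ∫ s in 0..t, renewalRate w (t₀ - s) := fun t ht =>
    intervalIntegral.integral_nonneg ht fun s _ => renewalRate_nonneg w _
  have hite : ∀ t, (0 : ℝ) ≤ if t₀ < t then 1 else 0 := fun t => by split_ifs <;> norm_num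
  have hm : ∀ t, 0 ≤ t → starMeasure w (θ / lam) t₀ (Iio t) =
      ENNReal.ofReal (starPayment θ lam t₀ (fun s => renewalRate w (t₀ - s)) t) := by
    intro t ht
    have h1 : (volume.restrict (Ici 0)).withDensity
        (fun x => renewalDensity (weightDensity w) (t₀ - x)) (Iio t)
        = ENNReal.ofReal (∫ s in 0..t, renewalRate w (t₀ - s)) := by
      rw [withDensity_apply _ measurableSet_Iio, intervalIntegral.integral_of_le ht,
        ofReal_integral_eq_lintegral_ofReal (hw.intervalIntegrable_renewalRate_sub t₀ 0 t).1
          (ae_of_all _ fun s => renewalRate_nonneg w _),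
        Measure.restrict_restrict measurableSet_Iio, Iio_inter_Ici, restrict_Ico_eq_restrict_Ioc]
      simp only [hw.ofReal_renewalRate]
    have h2 : Measure.dirac t₀ (Iio t) = ENNReal.ofReal (if t₀ < t then 1 else 0) := by
      rw [Measure.dirac_apply' _ measurableSet_Iio]
      by_cases h : t₀ < t <;> simp [h]
    rw [starMeasure, Measure.smul_apply, Measure.add_apply, h1, h2,
      ← ENNReal.ofReal_add (hI t ht) (hite t), smul_eq_mul, ← ENNReal.ofReal_mul hc, starPayment,
      hw.integral_renewalRate_sub, add_comm]
  refine ⟨?_, hm, fun t ht => ?_⟩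
  · rw [hm 0 le_rfl]
    simp [starPayment, ht₀, not_lt.2 ht₀]
  · rw [starPayment, hw.integral_renewalRate_sub]
    exact mul_nonneg hc (add_nonneg (hite t) (hI t ht))

/-- After the reflection `x ↦ t₀ - x`, the atom and the density contribute `K` and `R * K` at `t₀ -
s ≥ 0`, which sum to `1`. -/
theorem futureCost_star (hw : IsWeighting w) {s : ℝ} (hs : s ∈ Icc 0 t₀) :
    futureCost w (starMeasure w c t₀) s = ENNReal.ofReal c := by
  have hA := hw.isDelayDensity
  have hR := hA.measurable_renewalDensity
  have hK := measurable_survival (volume.withDensity (weightDensity w))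
  have hK' : Measurable fun x => survival (volume.withDensity (weightDensity w)) (x - s) :=
    hK.comp (measurable_id.sub measurable_const)
  have hR' : Measurable fun x => renewalDensity (weightDensity w) (t₀ - x) :=
    hR.comp (measurable_const.sub measurable_id)
  have h1 : ∫⁻ x, survival (volume.withDensity (weightDensity w)) (x - s)
        ∂((volume.restrict (Ici 0)).withDensity
          (fun x => renewalDensity (weightDensity w) (t₀ - x)))
      = mconv (volume.withDensity (renewalDensity (weightDensity w)))
          (survival (volume.withDensity (weightDensity w))) (t₀ - s) := by
    rw [lintegral_withDensity_eq_lintegral_mul _ hR' hK', mconv_withDensity hR hK,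
      ← lintegral_indicator measurableSet_Ici, ← lintegral_sub_left_eq_self _ t₀]
    refine lintegral_congr fun x => ?_
    rcases le_or_gt 0 (t₀ - x) with hx | hx
    · rw [indicator_of_mem (mem_Ici.2 hx), Pi.mul_apply, sub_sub_cancel, sub_right_comm]
    · rw [indicator_of_notMem (by simpa using hx), survival_of_neg _ (by linarith [hs.1]),
        mul_zero]
  rw [futureCost, starMeasure, lintegral_smul_measure, lintegral_add_measure, h1,
    lintegral_dirac' _ hK', add_comm, hA.survival_add_mconv_renewalDensity,
    indicator_of_mem (mem_Ici.2 (sub_nonneg.2 hs.2)), Pi.one_apply, smul_eq_mul, mul_one]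

theorem ae_le_star (hw : IsWeighting w) : ∀ᵐ x ∂(starMeasure w c t₀), x ≤ t₀ := by
  refine Measure.ae_smul_measure ?_ _
  rw [ae_add_measure_iff]
  constructor
  · have hR := hw.isDelayDensity.measurable_renewalDensity
    have hR' : Measurable fun x => renewalDensity (weightDensity w) (t₀ - x) :=
      hR.comp (measurable_const.sub measurable_id)
    rw [ae_withDensity_iff hR']
    filter_upwards with x hx
    by_contra! h
    exact hx (hw.isDelayDensity.renewalDensity_eq_zero (by linarith))
  · rw [ae_dirac_iff measurableSet_Iic]

theorem futureCost_eq_zero {m : Measure ℝ} (hm : ∀ᵐ x ∂m, x ≤ t₀) {s : ℝ} (hs : t₀ < s) :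
    futureCost w m s = 0 := by
  refine (lintegral_congr_ae ?_).trans lintegral_zero
  filter_upwards [hm] with x hx
  exact survival_of_neg _ (by linarith)

theorem measurable_indicator_multiplier (hw : IsWeighting w) (t₀ : ℝ) :
    Measurable ((Ioo 0 t₀).indicator fun s => ENNReal.ofReal (multiplier w s)) :=
  (hw.measurable_renewalRate.sub
    hw.continuous_expRenewal.measurable).ennreal_ofReal.indicator measurableSet_Ioo

theorem mconv_multiplierMeasure (hw : IsWeighting w)
    (hpos : ∀ s ∈ Ioo 0 t₀, 0 < multiplier w s) {x : ℝ} (hx : 0 ≤ x) :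
    mconv (multiplierMeasure w t₀) (survival (volume.withDensity (weightDensity w))) x
      = ENNReal.ofReal (∫ s in 0..x, w (Real.exp (-x + s)) * (Ioo 0 t₀).indicator (multiplier w) s)
    := by
  refine hw.mconv_survival_eq_ofReal (hw.measurable_indicator_multiplier t₀)
    (fun s hs => indicator_of_notMem (by simp [hs.le]) _) hx (fun s _ => ?_) (fun s _ => ?_) ?_
  · by_cases h : s ∈ Ioo 0 t₀
    · rw [indicator_of_mem h, indicator_of_mem h]
    · rw [indicator_of_notMem h, indicator_of_notMem h, ENNReal.ofReal_zero]
  · exact indicator_nonneg (fun s hs => (hpos s hs).le) s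
  · exact ⟨(hw.intervalIntegrable_multiplier 0 x).1.indicator measurableSet_Ioo,
      (hw.intervalIntegrable_multiplier 0 x).2.indicator measurableSet_Ioo⟩

theorem survival_add_mconv_multiplierMeasure (hw : IsWeighting w)
    (hpos : ∀ s ∈ Ioo 0 t₀, 0 < multiplier w s) {x : ℝ} (hx : x ∈ Icc 0 t₀) :
    survival (volume.withDensity (weightDensity w)) x
      + mconv (multiplierMeasure w t₀) (survival (volume.withDensity (weightDensity w))) x
      = ENNReal.ofReal (Real.exp (-x)) := by
  have h1 : ∫ s in 0..x, w (Real.exp (-x + s)) * (Ioo 0 t₀).indicator (multiplier w) s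
      = Real.exp (-x) - w (Real.exp (-x)) := by
    rw [← hw.integral_kernel_mul_multiplier hx.1]
    refine intervalIntegral.integral_congr_uIoo fun s hs => ?_
    rw [uIoo_of_le hx.1] at hs
    have hs' : s ∈ Ioo 0 t₀ := ⟨hs.1, hs.2.trans_le hx.2⟩
    rw [indicator_of_mem hs']
  have hk : 0 ≤ w (Real.exp (-x)) := by simpa using hw.kernel_nonneg hx.1
  rw [hw.mconv_multiplierMeasure hpos hx.1, hw.survival_eq hx.1, ← ENNReal.ofReal_add hk, h1]
  · congr 1
    ring
  · exact intervalIntegral.integral_nonneg hx.1 fun s hs =>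
      mul_nonneg (hw.kernel_nonneg hs.2) (indicator_nonneg (fun s hs => (hpos s hs).le) s)

theorem exp_neg_lt_survival_add_mconv (hw : IsWeighting w) (ht₀ : 0 < t₀)
    (hpos : ∀ s ∈ Ioo 0 t₀, 0 < multiplier w s) (hzero : multiplier w t₀ ≤ 0) {x : ℝ}
    (hx : t₀ < x) :
    ENNReal.ofReal (Real.exp (-x)) < survival (volume.withDensity (weightDensity w)) x
      + mconv (multiplierMeasure w t₀) (survival (volume.withDensity (weightDensity w))) x := by
  have hx0 : 0 ≤ x := (ht₀.trans hx).le
  have hgi : ∀ a b, IntervalIntegrable ((Ioo 0 t₀).indicator (multiplier w)) volume a b :=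
    fun a b => ⟨(hw.intervalIntegrable_multiplier a b).1.indicator measurableSet_Ioo,
      (hw.intervalIntegrable_multiplier a b).2.indicator measurableSet_Ioo⟩
  have h1 : ∫ s in 0..x, w (Real.exp (-x + s)) * (Ioo 0 t₀).indicator (multiplier w) s
      = ∫ s in 0..t₀, w (Real.exp (-x + s)) * multiplier w s := by
    rw [← intervalIntegral.integral_add_adjacent_intervals
      (hw.intervalIntegrable_kernel_mul hx0 hx.le (hgi 0 t₀))
      (hw.intervalIntegrable_kernel_mul hx.le le_rfl (hgi t₀ x))]
    have h2 : ∫ s in t₀..x, w (Real.exp (-x + s)) * (Ioo 0 t₀).indicator (multiplier w) s = 0 := by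
      rw [← intervalIntegral.integral_zero (a := t₀) (b := x)]
      refine intervalIntegral.integral_congr fun s hs => ?_
      rw [uIcc_of_le hx.le] at hs
      rw [indicator_of_notMem fun h => h.2.not_ge hs.1, mul_zero]
    rw [h2, add_zero]
    refine intervalIntegral.integral_congr_uIoo fun s hs => ?_
    rw [uIoo_of_le ht₀.le] at hs
    rw [indicator_of_mem hs]
  have hk : 0 ≤ w (Real.exp (-x)) := by simpa using hw.kernel_nonneg hx0
  have hlt := hw.exp_neg_lt_kernel_add_integral ht₀ hpos hzero hx
  rw [hw.mconv_multiplierMeasure hpos hx0, hw.survival_eq hx0, ← ENNReal.ofReal_add hk, h1,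
    ENNReal.ofReal_lt_ofReal_iff ((Real.exp_pos _).trans hlt)]
  · exact hlt
  · exact intervalIntegral.integral_nonneg hx0 fun s hs =>
      mul_nonneg (hw.kernel_nonneg hs.2) (indicator_nonneg (fun s hs => (hpos s hs).le) s)

end IsWeighting

/-- Tonelli exchanges payments and multipliers. The full multiplier is `δ₀ + Γ`: its unit atom
prices the constraint at time `0`. -/
theorem lintegral_survival_add_mconv (w : ℝ → ℝ) (m Γ : Measure ℝ) [SFinite m] [SFinite Γ] :
    ∫⁻ x, (survival (volume.withDensity (weightDensity w)) x
      + mconv Γ (survival (volume.withDensity (weightDensity w))) x) ∂m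
      = futureCost w m 0 + ∫⁻ s, futureCost w m s ∂Γ := by
  rw [lintegral_add_left (measurable_survival _)]
  unfold mconv futureCost
  rw [lintegral_lintegral_swap]
  · simp only [sub_zero]
  · exact ((measurable_survival _).comp (measurable_fst.sub measurable_snd)).aemeasurable

theorem DIR.futureCost_le {Ω : Type*} [MeasurableSpace Ω] {P : Measure Ω} {τ : Ω → ℝ}
    {w T : ℝ → ℝ} {θ lam : ℝ} {m : Measure ℝ} [SFinite m] (hD : DIR P τ w θ lam T)
    (hw : IsWeighting w) (hτ : IsExpTime P τ) (hm : IsPaymentMeasure m T) (hlam : 0 < lam) {s : ℝ}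
    (hs : 0 ≤ s) : futureCost w m s ≤ ENNReal.ofReal (θ / lam) := by
  have h := hD s hs (by rw [hτ.tail s hs]; exact ENNReal.ofReal_pos.2 (Real.exp_pos _))
  rw [perceivedCost_eq hw hτ hm lam hs] at h
  rw [ENNReal.ofReal_div_of_pos hlam, ENNReal.le_div_iff_mul_le
    (Or.inl (ENNReal.ofReal_pos.2 hlam).ne') (Or.inl ENNReal.ofReal_ne_top), mul_comm]
  exact h

namespace IsWeighting

variable {w : ℝ → ℝ} {t₀ : ℝ} {c : ℝ≥0∞} {m : Measure ℝ}

theorem ae_multiplierMeasure_iff (hw : IsWeighting w)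
    (hpos : ∀ s ∈ Ioo 0 t₀, 0 < multiplier w s) {p : ℝ → Prop} :
    (∀ᵐ s ∂(multiplierMeasure w t₀), p s) ↔ ∀ᵐ s, s ∈ Ioo 0 t₀ → p s := by
  rw [multiplierMeasure, ae_withDensity_iff (hw.measurable_indicator_multiplier t₀)]
  refine eventually_congr (Eventually.of_forall fun s => imp_congr_left ?_)
  rw [indicator_apply_ne_zero]
  exact ⟨fun h => h.1, fun h => ⟨h, (ENNReal.ofReal_pos.2 (hpos s h)).ne'⟩⟩

theorem multiplierMeasure_univ_ne_top (hw : IsWeighting w) (ht₀ : 0 ≤ t₀) :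
    multiplierMeasure w t₀ univ ≠ ∞ := by
  rw [multiplierMeasure, withDensity_apply _ MeasurableSet.univ, Measure.restrict_univ,
    lintegral_indicator measurableSet_Ioo]
  have h := (intervalIntegrable_iff_integrableOn_Ioo_of_le ht₀).1
    (hw.intervalIntegrable_multiplier 0 t₀)
  exact h.lintegral_lt_top.ne

theorem exp_neg_le_survival_add_mconv (hw : IsWeighting w) (ht₀ : 0 < t₀)
    (hpos : ∀ s ∈ Ioo 0 t₀, 0 < multiplier w s) (hzero : multiplier w t₀ ≤ 0) {x : ℝ}
    (hx : 0 ≤ x) :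
    ENNReal.ofReal (Real.exp (-x)) ≤ survival (volume.withDensity (weightDensity w)) x
      + mconv (multiplierMeasure w t₀) (survival (volume.withDensity (weightDensity w))) x := by
  rcases le_or_gt x t₀ with h | h
  · exact (hw.survival_add_mconv_multiplierMeasure hpos ⟨hx, h⟩).ge
  · exact (hw.exp_neg_lt_survival_add_mconv ht₀ hpos hzero h).le

theorem lintegral_futureCost_le (hw : IsWeighting w)
    (hpos : ∀ s ∈ Ioo 0 t₀, 0 < multiplier w s)
    (hC : ∀ s, 0 ≤ s → futureCost w m s ≤ c) :
    ∫⁻ s, futureCost w m s ∂(multiplierMeasure w t₀) ≤ c * multiplierMeasure w t₀ univ := by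
  rw [← lintegral_const]
  exact lintegral_mono_ae ((hw.ae_multiplierMeasure_iff hpos).2
    (ae_of_all _ fun s hs => hC s hs.1.le))

/-- Weak duality: the multiplier bounds the expected payment. -/
theorem lintegral_exp_neg_le [SFinite m] (hw : IsWeighting w) (ht₀ : 0 < t₀)
    (hpos : ∀ s ∈ Ioo 0 t₀, 0 < multiplier w s) (hzero : multiplier w t₀ ≤ 0)
    (hm : ∀ᵐ x ∂m, 0 ≤ x) (hC : ∀ s, 0 ≤ s → futureCost w m s ≤ c) :
    ∫⁻ x, ENNReal.ofReal (Real.exp (-x)) ∂m ≤ c + c * multiplierMeasure w t₀ univ := by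
  have : SFinite (multiplierMeasure w t₀) := by unfold multiplierMeasure; infer_instance
  refine (lintegral_mono_ae (hm.mono fun x hx =>
    hw.exp_neg_le_survival_add_mconv ht₀ hpos hzero hx)).trans ?_
  rw [lintegral_survival_add_mconv]
  exact add_le_add (hC 0 le_rfl) (hw.lintegral_futureCost_le hpos hC)

/-- No duality gap: payments before `t₀` with binding constraints attain the bound. -/
theorem lintegral_exp_neg_eq [SFinite m] (hw : IsWeighting w) (ht₀ : 0 < t₀)
    (hpos : ∀ s ∈ Ioo 0 t₀, 0 < multiplier w s) (hm : ∀ᵐ x ∂m, 0 ≤ x) (hm' : ∀ᵐ x ∂m, x ≤ t₀)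
    (hC : ∀ s ∈ Icc 0 t₀, futureCost w m s = c) :
    ∫⁻ x, ENNReal.ofReal (Real.exp (-x)) ∂m = c + c * multiplierMeasure w t₀ univ := by
  have : SFinite (multiplierMeasure w t₀) := by unfold multiplierMeasure; infer_instance
  have h1 : ∀ᵐ x ∂m, ENNReal.ofReal (Real.exp (-x))
      = survival (volume.withDensity (weightDensity w)) x
        + mconv (multiplierMeasure w t₀) (survival (volume.withDensity (weightDensity w))) x := by
    filter_upwards [hm, hm'] with x hx hx'
    exact (hw.survival_add_mconv_multiplierMeasure hpos ⟨hx, hx'⟩).symm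
  rw [lintegral_congr_ae h1, lintegral_survival_add_mconv, hC 0 ⟨le_rfl, ht₀.le⟩,
    ← lintegral_const]
  congr 1
  exact lintegral_congr_ae ((hw.ae_multiplierMeasure_iff hpos).2
    (ae_of_all _ fun s hs => hC s ⟨hs.1.le, hs.2.le⟩))

/-- Complementary slackness. -/
theorem complementary_slackness [SFinite m] (hw : IsWeighting w) (ht₀ : 0 < t₀)
    (hpos : ∀ s ∈ Ioo 0 t₀, 0 < multiplier w s) (hzero : multiplier w t₀ ≤ 0)
    (hm : ∀ᵐ x ∂m, 0 ≤ x) (hc : c ≠ ∞) (hC : ∀ s, 0 ≤ s → futureCost w m s ≤ c)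
    (hopt : c + c * multiplierMeasure w t₀ univ ≤ ∫⁻ x, ENNReal.ofReal (Real.exp (-x)) ∂m) :
    (∀ᵐ x ∂m, x ≤ t₀) ∧ futureCost w m 0 = c ∧
      ∀ᵐ s, s ∈ Ioo 0 t₀ → futureCost w m s = c := by
  have : SFinite (multiplierMeasure w t₀) := by unfold multiplierMeasure; infer_instance
  have hΓ : c * multiplierMeasure w t₀ univ ≠ ∞ :=
    ENNReal.mul_ne_top hc (hw.multiplierMeasure_univ_ne_top ht₀.le)
  have hmono := hm.mono fun x hx => hw.exp_neg_le_survival_add_mconv ht₀ hpos hzero hx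
  have hI := hw.lintegral_futureCost_le hpos hC
  have hle := lintegral_mono_ae hmono
  have hsum := lintegral_survival_add_mconv w m (multiplierMeasure w t₀)
  rw [hsum] at hle
  -- Every inequality of weak duality becomes an equality. Finiteness is what allows equal integrals
  -- of ordered functions to give equality almost everywhere.
  have hfin : ∫⁻ x, ENNReal.ofReal (Real.exp (-x)) ∂m ≠ ∞ :=
    (hle.trans_lt ((add_le_add (hC 0 le_rfl) hI).trans_lt
      (ENNReal.add_lt_top.2 ⟨hc.lt_top, hΓ.lt_top⟩))).ne
  have h0 : futureCost w m 0 = c := by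
    refine le_antisymm (hC 0 le_rfl) ?_
    exact (ENNReal.add_le_add_iff_right hΓ).1 ((hopt.trans hle).trans (add_le_add le_rfl hI))
  have h1 : c * multiplierMeasure w t₀ univ ≤ ∫⁻ s, futureCost w m s ∂(multiplierMeasure w t₀) := by
    have h := hopt.trans hle
    rw [h0] at h
    exact (ENNReal.add_le_add_iff_left hc).1 h
  refine ⟨?_, h0, ?_⟩
  · have hmeas : Measurable fun x => survival (volume.withDensity (weightDensity w)) x
        + mconv (multiplierMeasure w t₀) (survival (volume.withDensity (weightDensity w))) x :=
      (measurable_survival _).add (measurable_mconv (measurable_survival _))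
    have heq := ae_eq_of_ae_le_of_lintegral_le hmono hfin hmeas.aemeasurable
      (by rw [hsum]; exact (add_le_add (hC 0 le_rfl) hI).trans hopt)
    filter_upwards [heq] with x hx
    -- The dual constraint is strict beyond `t₀`, so no payment can be made there.
    by_contra! hlt
    exact (hw.exp_neg_lt_survival_add_mconv ht₀ hpos hzero hlt).ne hx
  · rw [← hw.ae_multiplierMeasure_iff hpos]
    refine ae_eq_of_ae_le_of_lintegral_le (g := fun _ => c) ?_ (hI.trans_lt hΓ.lt_top).ne
      aemeasurable_const (by rwa [lintegral_const])
    exact (hw.ae_multiplierMeasure_iff hpos).2 (ae_of_all _ fun s hs => hC s hs.1.le)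

/-- Payment measures on `[0, t₀]` are determined by their future costs. -/
theorem measure_Ici_congr (hw : IsWeighting w) {m₁ m₂ : Measure ℝ} [SFinite m₁] [SFinite m₂]
    (h₁ : ∀ᵐ x ∂m₁, x ≤ t₀) (h₂ : ∀ᵐ x ∂m₂, x ≤ t₀)
    (hae : ∀ᵐ s, s ∈ Ioo 0 t₀ → futureCost w m₁ s = futureCost w m₂ s) {t : ℝ} (ht : 0 ≤ t)
    (htC : futureCost w m₁ t = futureCost w m₂ t) : m₁ (Ici t) = m₂ (Ici t) := by
  -- Under the reflection at `t₀` the future cost becomes a convolution with the survival function,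
  -- to which the inversion formula applies.
  have hmeas : Measurable fun x : ℝ => t₀ - x := measurable_const.sub measurable_id
  have hconv : ∀ (m : Measure ℝ) (u : ℝ), mconv (m.map fun x => t₀ - x)
      (survival (volume.withDensity (weightDensity w))) u = futureCost w m (t₀ - u) := by
    intro m u
    have hK : Measurable fun x => survival (volume.withDensity (weightDensity w)) (u - x) :=
      (measurable_survival _).comp (measurable_const.sub measurable_id)
    rw [mconv, lintegral_map hK hmeas]
    refine lintegral_congr fun x => ?_
    congr 1
    ring
  have hIci : ∀ m : Measure ℝ, (m.map fun x => t₀ - x) (Iic (t₀ - t)) = m (Ici t) := by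
    intro m
    rw [Measure.map_apply hmeas measurableSet_Iic]
    congr 1
    ext x
    simp
  rw [← hIci, ← hIci]
  refine hw.isDelayDensity.measure_Iic_congr (by rwa [hconv, hconv, sub_sub_cancel]) ?_
  have hne : ∀ᵐ s : ℝ, s ≠ 0 := by simp [ae_iff]
  filter_upwards [(quasiMeasurePreserving_sub_left_of_right_invariant volume t₀).ae hae, hne]
    with s hs hs0 hst
  rw [hconv, hconv]
  rcases lt_or_gt_of_ne hs0 with h | h
  · rw [futureCost_eq_zero h₁ (by linarith), futureCost_eq_zero h₂ (by linarith)]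
  · exact hs ⟨by linarith, by linarith⟩

theorem eq_of_futureCost_eq (hw : IsWeighting w) {m₁ m₂ : Measure ℝ} [SFinite m₁] [SFinite m₂]
    {T₁ T₂ : ℝ → ℝ} (hT₁ : IsPaymentMeasure m₁ T₁) (hT₂ : IsPaymentMeasure m₂ T₂)
    (h₁ : ∀ᵐ x ∂m₁, x ≤ t₀) (h₂ : ∀ᵐ x ∂m₂, x ≤ t₀)
    (hC0 : futureCost w m₁ 0 = futureCost w m₂ 0)
    (hae : ∀ᵐ s, s ∈ Ioo 0 t₀ → futureCost w m₁ s = futureCost w m₂ s) {t : ℝ} (ht : 0 ≤ t) :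
    T₁ t = T₂ t := by
  have hreal : ∀ {t}, 0 ≤ t → m₁ (Iio t) = m₂ (Iio t) → T₁ t = T₂ t := by
    intro t ht h
    rwa [hT₁.Iio_eq t ht, hT₂.Iio_eq t ht,
      ENNReal.ofReal_eq_ofReal_iff (hT₁.nonneg t ht) (hT₂.nonneg t ht)] at h
  have hafter : ∀ {m : Measure ℝ}, m (Iio 0) = 0 → (∀ᵐ x ∂m, x ≤ t₀) → ∀ {t}, t₀ < t →
      m (Iio t) = m (Ici 0) := by
    intro m hm0 hm t ht
    refine measure_congr ?_
    have hm0' : ∀ᵐ x ∂m, 0 ≤ x := by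
      rw [ae_iff]
      simp only [not_le]
      exact hm0
    filter_upwards [hm0', hm] with x hx hx'
    exact propext ⟨fun _ => hx, fun _ => hx'.trans_lt ht⟩
  -- The constraint at time `0` fixes the total payment. Tail masses, known for almost every time,
  -- then fix `T` almost everywhere on `(0, t₀)` by subtraction, and left-continuity extends this to
  -- all of `(0, t₀]`.
  have htot : m₁ (Ici 0) = m₂ (Ici 0) := hw.measure_Ici_congr h₁ h₂ hae le_rfl hC0
  have hsplit : ∀ {m : Measure ℝ}, m (Iio 0) = 0 → ∀ {t : ℝ}, 0 ≤ t →
      m (Iio t) + m (Ici t) = m (Ici 0) := by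
    intro m hm0 t ht
    have hu : ∀ t : ℝ, m (Iio t) + m (Ici t) = m univ := fun t => by
      rw [← measure_union (Iio_disjoint_Ici le_rfl) measurableSet_Ici, Iio_union_Ici]
    rw [hu t, ← hu 0, hm0, zero_add]
  rcases lt_or_ge t₀ t with h | h
  · refine hreal ht ?_
    rw [hafter hT₁.Iio_zero h₁ h, hafter hT₂.Iio_zero h₂ h, htot]
  rcases ht.eq_or_lt with rfl | ht0
  · rw [hT₁.map_zero, hT₂.map_zero]
  have hTae : ∀ᵐ x, x ∈ Ioo 0 t₀ → T₁ x = T₂ x := by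
    filter_upwards [hae] with x hx hxm
    refine hreal hxm.1.le ?_
    have hI := hw.measure_Ici_congr h₁ h₂ hae hxm.1.le (hx hxm)
    have hs := (hsplit hT₁.Iio_zero hxm.1.le).trans
      (htot.trans (hsplit hT₂.Iio_zero hxm.1.le).symm)
    rw [hI] at hs
    refine (ENNReal.add_left_inj ?_).1 hs
    refine ((measure_mono (Ici_subset_Ici.2 hxm.1.le)).trans_lt ?_).ne
    rw [← hafter hT₂.Iio_zero h₂ (lt_add_one t₀), hT₂.Iio_eq _ (by linarith)]
    exact ENNReal.ofReal_lt_top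
  exact le_antisymm (hT₁.le_of_ae_eq hT₂ hTae ⟨ht0, h⟩)
    (hT₂.le_of_ae_eq hT₁ (hTae.mono fun x hx hxm => (hx hxm).symm) ⟨ht0, h⟩)

end IsWeighting

/-! ### The proposition -/

theorem mainTheorem4 (w : ℝ → ℝ) (hw : IsWeighting w) (θ lam : ℝ) (hθ : 0 ≤ θ) (hlam : 0 < lam)
    {Ω : Type*} [MeasurableSpace Ω] (P : Measure Ω) [IsProbabilityMeasure P]
    (τ : Ω → ℝ) (hτ : IsExpTime P τ) :
    ∃ p₁ : ℝ, (p₁ ∈ Ioo (0 : ℝ) 1 ∧ w p₁ = p₁ ∧ ∀ p ∈ Ioo (0 : ℝ) 1, w p = p → p = p₁) ∧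
    -- the multiplier equation: unique solution in L¹, continuous on (0, -log p₁],
    -- with g₀(0+) = w'(1) - 1
    ∃ g₀ : ℝ → ℝ,
      (SolvesMultiplierEq w (-Real.log p₁) g₀ ∧
        ContinuousOn g₀ (Ioc 0 (-Real.log p₁)) ∧
        (∀ d : EReal, HasExtDerivWithin w (Icc 0 1) 1 d →
          Tendsto (fun t => ((g₀ t : ℝ) : EReal)) (𝓝[>] 0) (𝓝 (d - 1))) ∧
        ∀ g : ℝ → ℝ, SolvesMultiplierEq w (-Real.log p₁) g →
          g =ᵐ[volume.restrict (Icc 0 (-Real.log p₁))] g₀) ∧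
    ∃ t₀ : ℝ, IsLeast {t | t ∈ Ioc 0 (-Real.log p₁) ∧ g₀ t ≤ 0} t₀ ∧
    -- the binding equation: unique solution in L¹
    ∃ f : ℝ → ℝ,
      (SolvesBindingEq w t₀ f ∧
        ∀ f' : ℝ → ℝ, SolvesBindingEq w t₀ f' → f' =ᵐ[volume.restrict (Icc 0 t₀)] f) ∧
      -- DIR binds on [0, t₀]
      (∀ s ∈ Icc 0 t₀,
        perceivedCost P τ w lam (starPayment θ lam t₀ f) s = ENNReal.ofReal θ) ∧
      IsOptimalPayment P τ w θ lam (starPayment θ lam t₀ f) ∧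
      ∀ T : ℝ → ℝ, IsOptimalPayment P τ w θ lam T →
        ∀ t : ℝ, 0 ≤ t → T t = starPayment θ lam t₀ f t := by
  obtain ⟨p₁, hp₁, hwp₁, hp₁u⟩ := hw.existsUnique_fixedPoint
  have ht₁ : 0 ≤ -Real.log p₁ := (neg_pos.2 (Real.log_neg hp₁.1 hp₁.2)).le
  obtain ⟨t₀, ht₀⟩ := hw.exists_isLeast_multiplier_nonpos hp₁ hwp₁
  have ht₀0 : 0 < t₀ := ht₀.1.1.1
  have hzero : multiplier w t₀ ≤ 0 := ht₀.1.2
  have hpos : ∀ s ∈ Ioo 0 t₀, 0 < multiplier w s := by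
    intro s hs
    by_contra! h
    exact (ht₀.2 ⟨⟨hs.1, hs.2.le.trans ht₀.1.1.2⟩, h⟩).not_gt hs.2
  refine ⟨p₁, ⟨hp₁, hwp₁, hp₁u⟩, multiplier w, ⟨hw.solvesMultiplierEq ht₁,
    hw.continuousOn_multiplier.mono Ioc_subset_Ioi_self, fun d hd => hw.tendsto_multiplier hd,
    fun g hg => hw.ae_eq_of_solvesMultiplierEq ht₁ hg⟩, t₀, ht₀,
    fun s => renewalRate w (t₀ - s), ⟨hw.solvesBindingEq ht₀0.le,
    fun f' hf' => hw.ae_eq_of_solvesBindingEq ht₀0.le hf'⟩, ?_⟩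
  have : SFinite (starMeasure w (θ / lam) t₀) := by unfold starMeasure; infer_instance
  have hstar := hw.isPaymentMeasure_star hθ hlam ht₀0.le
  have hcost : ∀ s, 0 ≤ s → perceivedCost P τ w lam
      (starPayment θ lam t₀ fun s => renewalRate w (t₀ - s)) s
      = ENNReal.ofReal lam * futureCost w (starMeasure w (θ / lam) t₀) s := fun s hs =>
    perceivedCost_eq hw hτ hstar lam hs
  have hbind : ∀ s ∈ Icc 0 t₀, perceivedCost P τ w lam
      (starPayment θ lam t₀ fun s => renewalRate w (t₀ - s)) s = ENNReal.ofReal θ := by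
    intro s hs
    rw [hcost s hs.1, hw.futureCost_star hs, ← ENNReal.ofReal_mul hlam.le,
      mul_div_cancel₀ _ hlam.ne']
  have hDIR : DIR P τ w θ lam (starPayment θ lam t₀ fun s => renewalRate w (t₀ - s)) := by
    intro s hs _
    rcases le_or_gt s t₀ with h | h
    · exact (hbind s ⟨hs, h⟩).le
    · rw [hcost s hs, IsWeighting.futureCost_eq_zero hw.ae_le_star h, mul_zero]
      exact zero_le
  have hprofit : profit P τ (starPayment θ lam t₀ fun s => renewalRate w (t₀ - s))
      = ENNReal.ofReal (θ / lam) + ENNReal.ofReal (θ / lam) * multiplierMeasure w t₀ univ := by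
    rw [profit_eq hτ hstar]
    exact hw.lintegral_exp_neg_eq ht₀0 hpos hstar.ae_nonneg hw.ae_le_star
      fun s hs => hw.futureCost_star hs
  refine ⟨hbind, ⟨hw.isPayment_star hθ hlam ht₀0.le, hDIR, fun T hT hTD => ?_⟩,
    fun T hT t ht => ?_⟩
  · obtain ⟨m, _, hm⟩ := hT.exists_measure
    rw [hprofit, profit_eq hτ hm]
    exact hw.lintegral_exp_neg_le ht₀0 hpos hzero hm.ae_nonneg
      fun s hs => hTD.futureCost_le hw hτ hm hlam hs
  · obtain ⟨m, _, hm⟩ := hT.1.exists_measure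
    -- Comparison with the candidate shows that an optimal `T` reaches the dual value, which is the
    -- hypothesis of complementary slackness.
    have hopt := hT.2.2 _ (hw.isPayment_star hθ hlam ht₀0.le) hDIR
    rw [hprofit, profit_eq hτ hm] at hopt
    obtain ⟨h1, h2, h3⟩ := hw.complementary_slackness ht₀0 hpos hzero hm.ae_nonneg
      ENNReal.ofReal_ne_top (fun s hs => hT.2.1.futureCost_le hw hτ hm hlam hs) hopt
    refine hw.eq_of_futureCost_eq hm hstar h1 hw.ae_le_star ?_ ?_ ht
    · rw [h2, hw.futureCost_star ⟨le_rfl, ht₀0.le⟩]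
    · filter_upwards [h3] with s hs hst
      rw [hs hst, hw.futureCost_star ⟨hst.1.le, hst.2.le⟩]
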